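/- **Setting.** Let $H$ be a complex Hilbert space, $J$ a complex conjugation (antiunitary involution) of $H$, and $Q$ an orthogonal projection commuting with $J$, of finite even rank $2n$, such that $Q^\perp=1-Q$ has infinite rank. On $H_Q=H\oplus Q^\perp H$ let $J_Q(f\oplus h)=(QJf+Jh)\oplus Q^\perp Jf$, and let $B(x)$, $x\in H_Q$, be the generators of the selfdual CAR algebra over $(H_Q,J_Q)$: $B$ is linear, $B(x)^*=B(J_Qx)$, $B(x)B(y)+B(y)B(x)=\langle J_Qx,y\rangle 1$. Put $G(f)=B(f\oplus 0)$. The GAR algebra $\mathfrak G$ is the norm-closed unital subalgebra generated by all $G(f)$, $f\in H$; its Grassmann part $\Lambda\subset\mathfrak G$ is the norm-closed unital subalgebra generated by $G(f)$, $f\in Q^\perp H$; $\Lambda_1\subset\Lambda$ is the odd part (closed span of products of an odd number of these generators). The (even) anticommutative phase space is $\Xi=QH\otimes\Lambda_1$. For $u\in QH$ the component $\xi_u\in\Lambda_1$ of $\xi\in \Xi$ is determined by $(f\otimes\lambda)_u=\langle u,f\rangle\lambda$. Let $\sigma:\Xi\times\Xi\to\Lambda$, $\sigma(\xi,\eta)=\langle\!\langle\xi^\star,\eta\rangle\!\rangle_Q$,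 be the bilinear form with $\sigma(f\otimes\lambda,h\otimes\mu)=-\langle Jf,h\rangle\lambda\mu$; let $\Phi:\Xi\to\mathfrak G$ be the linear map with $\Phi(f\otimes\lambda)=G(f)\lambda$ (so that $[\Phi(\xi),\Phi(\eta)]=\sigma(\xi,\eta)$), $w(\xi)=\exp\Phi(\xi)$, and $\alpha_\xi(A)=w(-\xi)Aw(\xi)$. A G-holomorphic function with values in $M$ ($M=\Lambda$ or $M=\mathfrak G$) is a linear combination of functions $\xi\mapsto X\xi_{u_1}\cdots\xi_{u_k}$, $X\in M$, $u_i\in QH$; let $\mathcal O$ be the algebra of $\Lambda$-valued ones. Fix an orthonormal basis $e^1,\dots,e^{2n}$ of $QH$ with $Je^i=e^i$ and a form of highest degree $v=v_N\,e^1\wedge\cdots\wedge e^{2n}\in\bigwedge^{2n}QH$. If $F(\xi)=\sum_{I\subset N}F^I\xi_I$, $N=\{1,\dots,2n\}$, $\xi_I=\xi_{e^{i_1}}\cdots\xi_{e^{i_k}}$ for $I=\{i_1<\dots<i_k\}$, then $\int_Qv(\xi)F(\xi):=v_NF^N$. Fix a sign $\varepsilon\in\{1,-1\}$. For $f,f'\in\mathcal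 O$, $A\in\mathfrak G$ and a bounded linear $\varphi:\mathfrak G\to\Lambda$ with $\varphi(A\lambda)=\varphi(A)\lambda$ for $A\in\mathfrak G,\lambda\in\Lambda$ (a right module homomorphism), define the convolutions $$(f*f')(\xi)=\int_Qv(\eta)\,f(\eta)f'(\xi-\eta),\qquad A*f=\int_Qv(\eta)\,\alpha_{\varepsilon\eta}(A)f(\eta),\qquad(\varphi*A)(\xi)=\varphi(\alpha_{-\varepsilon\xi}(A)),$$ and the Fourier transforms $$(\mathcal Ff)(\xi)=\int_Qv(\eta)\,f(\eta)\,e^{\varepsilon\sigma(\xi,\eta)},\qquad(\mathcal FA)(\xi)=w(-\xi)\int_Qv(\eta)\,\alpha_{-\eta}(A)\,e^{\sigma(\xi,\eta)},\qquad(\mathcal F\varphi)(\xi)=\varphi(w(\xi)).$$ **Theorem.** For all $f,f'\in\mathcal O$, all $A\in\mathfrak G$, and all bounded right module homomorphisms $\varphi:\mathfrak G\to\Lambda$, the functions $f*f'$, $\varphi*A$, $\mathcal Ff$, $\mathcal FA$, $\mathcal F\varphi$ belong to $\mathcal O$, and $$\mathcal F(f*f')=\mathcal Ff\;\mathcal Ff',\qquad\mathcal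 F(\varphi*A)=\mathcal F\varphi\;\mathcal FA,\qquad\mathcal F(A*f)=\mathcal FA\;\mathcal Ff,$$ where the products are pointwise. -/

import Mathlib

set_option linter.unusedSimpArgs false
set_option linter.unnecessarySeqFocus false

open scoped ComplexConjugate InnerProductSpace

namespace CAR

section Fock

variable (K : Type*) [NormedAddCommGroup K] [InnerProductSpace ℂ K] [CompleteSpace K]

/-- Index set of a chosen Hilbert basis of `K`. -/
def Idx : Type _ := ↥(exists_hilbertBasis ℂ K).choose

/-- A chosen Hilbert basis of `K`. -/
noncomputable def basis : HilbertBasis (Idx K) ℂ K := (exists_hilbertBasis ℂ K).choose_spec.choose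

/-- An arbitrary total order on the index set (needed for the Jordan-Wigner signs). -/
noncomputable instance : LinearOrder (Idx K) :=
  haveI := Classical.decRel (WellOrderingRel (α := Idx K))
  linearOrderOfSTO WellOrderingRel

/-- The antisymmetric Fock space over `K`, in occupation number representation: its canonical
orthonormal basis is indexed by the finite sets `{i₁ < ⋯ < iₖ}` of indices and stands for the
vectors `e_{i₁} ∧ ⋯ ∧ e_{iₖ}`. -/
abbrev Fock : Type _ := lp (fun _ : Finset (Idx K) => ℂ) 2

/-- Bounded operators on Fock space. -/
abbrev Op : Type _ := Fock K →L[ℂ] Fock K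

variable {K}

/-- The Jordan-Wigner sign `(-1) ^ #{j ∈ S | j < i}`. -/
noncomputable def sgn (i : Idx K) (S : Finset (Idx K)) : ℂ := (-1) ^ (S.filter (· < i)).card

/-- The involution `S ↦ S ∆ {i}` on the finite sets of indices. -/
noncomputable def flip (i : Idx K) : Equiv.Perm (Finset (Idx K)) where
  toFun S := symmDiff S {i}
  invFun S := symmDiff S {i}
  left_inv S := by simp
  right_inv S := by simp

theorem flip_of_mem {i : Idx K} {S : Finset (Idx K)} (h : i ∈ S) : flip i S = S.erase i := by
  ext j; simp only [flip, Equiv.coe_fn_mk, Finset.mem_symmDiff, Finset.mem_singleton,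
    Finset.mem_erase]; grind

theorem flip_of_notMem {i : Idx K} {S : Finset (Idx K)} (h : i ∉ S) :
    flip i S = insert i S := by
  ext j; simp only [flip, Equiv.coe_fn_mk, Finset.mem_symmDiff, Finset.mem_singleton,
    Finset.mem_insert]; grind

theorem summable_sq (ψ : Fock K) : Summable fun S => ‖ψ S‖ ^ 2 := by
  have := (memℓp_gen_iff (p := 2) (by simp)).1 (lp.memℓp ψ)
  simpa using this

theorem norm_sq (ψ : Fock K) : ‖ψ‖ ^ 2 = ∑' S, ‖ψ S‖ ^ 2 := by
  have := lp.norm_rpow_eq_tsum (p := 2) (by simp) ψ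
  simpa using this

theorem shift_aux (i : Idx K) {u : Finset (Idx K) → ℂ} (hu : ∀ S, ‖u S‖ ≤ 1) (ψ : Fock K)
    (S : Finset (Idx K)) : ‖u S * ψ (flip i S)‖ ^ 2 ≤ ‖ψ (flip i S)‖ ^ 2 := by
  rw [norm_mul]
  exact pow_le_pow_left₀ (by positivity) (mul_le_of_le_one_left (norm_nonneg _) (hu S)) 2

theorem shift_summable (i : Idx K) {u : Finset (Idx K) → ℂ} (hu : ∀ S, ‖u S‖ ≤ 1) (ψ : Fock K) :
    Summable fun S => ‖u S * ψ (flip i S)‖ ^ 2 :=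
  Summable.of_nonneg_of_le (fun S => by positivity) (shift_aux i hu ψ)
    ((flip i).summable_iff.2 (summable_sq ψ))

/-- `ψ ↦ (S ↦ u S * ψ (S ∆ {i}))`, for a coefficient function `u` that is bounded by one. -/
noncomputable def shiftFun (i : Idx K) (u : Finset (Idx K) → ℂ) (hu : ∀ S, ‖u S‖ ≤ 1)
    (ψ : Fock K) : Fock K :=
  ⟨fun S => u S * ψ (flip i S), memℓp_gen (by simpa using shift_summable i hu ψ)⟩

theorem shiftFun_norm (i : Idx K) (u : Finset (Idx K) → ℂ) (hu : ∀ S, ‖u S‖ ≤ 1)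
    (ψ : Fock K) : ‖shiftFun i u hu ψ‖ ≤ 1 * ‖ψ‖ := by
  rw [one_mul, ← sq_le_sq₀ (norm_nonneg _) (norm_nonneg _), norm_sq, norm_sq,
    ← (flip i).tsum_eq (fun S => ‖ψ S‖ ^ 2)]
  exact Summable.tsum_le_tsum (shift_aux i hu ψ) (shift_summable i hu ψ)
    ((flip i).summable_iff.2 (summable_sq ψ))

/-- `shiftFun` as a bounded operator on Fock space. -/
noncomputable def shift (i : Idx K) (u : Finset (Idx K) → ℂ) (hu : ∀ S, ‖u S‖ ≤ 1) : Op K :=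
  LinearMap.mkContinuous
    { toFun := shiftFun i u hu
      map_add' := fun ψ φ => by
        ext S; exact mul_add (u S) (ψ (flip i S)) (φ (flip i S))
      map_smul' := fun c ψ => by
        ext S; exact mul_left_comm (u S) c (ψ (flip i S)) }
    1 (shiftFun_norm i u hu)

@[simp] theorem shift_apply (i : Idx K) (u : Finset (Idx K) → ℂ) (hu : ∀ S, ‖u S‖ ≤ 1)
    (ψ : Fock K) (S : Finset (Idx K)) : shift i u hu ψ S = u S * ψ (flip i S) := rfl

/-- Creation operator of the basis mode `i`:
`(c*ᵢ ψ)(S) = sgn(i, S) ψ(S ∖ {i})` if `i ∈ S`, and `0` otherwise. -/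
noncomputable def modeCreate (i : Idx K) : Op K :=
  shift i (fun S => if i ∈ S then sgn i S else 0) (fun S => by split_ifs <;> simp [sgn])

variable (K) in
/-- The creation operators `c*(f)`, `f ∈ K`: the bounded linear extension of `eᵢ ↦ c*ᵢ`. -/
noncomputable def create : K →L[ℂ] Op K :=
  LinearMap.extendOfNorm (Finsupp.linearCombination ℂ (modeCreate (K := K)))
    (Finsupp.linearCombination ℂ (basis K))

/-- Annihilation operator of the basis mode `i`. -/
noncomputable def modeAnnih (i : Idx K) : Op K :=
  shift i (fun S => if i ∈ S then 0 else sgn i S) (fun S => by split_ifs <;> simp [sgn])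

theorem adjoint_modeCreate (i : Idx K) :
    ContinuousLinearMap.adjoint (modeCreate i) = modeAnnih i := by
  symm
  rw [ContinuousLinearMap.eq_adjoint_iff]
  intro ψ φ
  rw [lp.inner_eq_tsum, lp.inner_eq_tsum, ← (flip i).tsum_eq]
  refine tsum_congr fun S => ?_
  have h2 : flip i (flip i S) = S := (flip i).left_inv S
  have hf : ∀ T : Finset (Idx K), (starRingEnd ℂ) (sgn i T) = sgn i T := by simp [sgn]
  by_cases h : i ∈ S
  · have h3 : sgn i (flip i S) = sgn i S := by
      rw [flip_of_mem h]; unfold sgn; congr 2; ext j; simp; grind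
    have h4 : i ∉ flip i S := by rw [flip_of_mem h]; simp
    simp [modeCreate, modeAnnih, h, h2, h3, h4, hf, mul_left_comm, mul_comm, mul_assoc]
  · have h4 : i ∈ flip i S := by rw [flip_of_notMem h]; simp
    simp [modeCreate, modeAnnih, h, h4]

theorem sgn_flip (i j : Idx K) (S : Finset (Idx K)) :
    sgn i (flip j S) = if j < i then - sgn i S else sgn i S := by
  by_cases h : j ∈ S
  · rw [flip_of_mem h]
    unfold sgn
    split_ifs with hji
    · rw [Finset.filter_erase]
      have : j ∈ S.filter (· < i) := by simp [h, hji]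
      rw [← Finset.card_erase_add_one this, pow_succ]; simp
    · congr 2; ext k; simp; grind
  · rw [flip_of_notMem h]
    unfold sgn
    split_ifs with hji
    · rw [Finset.filter_insert, if_pos hji, Finset.card_insert_of_notMem (by simp [h]), pow_succ]
      simp
    · rw [Finset.filter_insert, if_neg hji]

theorem mem_flip {i j : Idx K} {S : Finset (Idx K)} :
    i ∈ flip j S ↔ (if i = j then i ∉ S else i ∈ S) := by
  simp only [flip, Equiv.coe_fn_mk, Finset.mem_symmDiff, Finset.mem_singleton]
  split_ifs <;> grind

theorem flip_comm (i j : Idx K) (S : Finset (Idx K)) : flip i (flip j S) = flip j (flip i S) := by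
  simp only [flip, Equiv.coe_fn_mk]
  rw [symmDiff_assoc, symmDiff_assoc, symmDiff_comm ({j} : Finset (Idx K))]

theorem create_create (i j : Idx K) :
    modeCreate i * modeCreate j + modeCreate j * modeCreate i = 0 := by
  ext ψ S
  simp only [add_apply, mul_apply_eq_comp, lp.coeFn_add,
    Pi.add_apply, modeCreate, shift_apply, mem_flip, sgn_flip, flip_comm j i]
  rcases lt_trichotomy i j with h | h | h
  · by_cases h1 : i ∈ S <;> by_cases h2 : j ∈ S <;>
      simp [h, h.ne, h.ne', h.not_gt, h1, h2] <;> ring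
  · subst h; by_cases h1 : i ∈ S <;> simp [h1]
  · by_cases h1 : i ∈ S <;> by_cases h2 : j ∈ S <;>
      simp [h, h.ne, h.ne', h.not_gt, h1, h2] <;> ring

theorem annih_create (i j : Idx K) :
    modeAnnih i * modeCreate j + modeCreate j * modeAnnih i = if i = j then 1 else 0 := by
  ext ψ S
  simp only [add_apply, mul_apply_eq_comp, lp.coeFn_add,
    Pi.add_apply, modeCreate, modeAnnih, shift_apply, mem_flip, sgn_flip, flip_comm j i]
  rcases lt_trichotomy i j with h | h | h
  · by_cases h1 : i ∈ S <;> by_cases h2 : j ∈ S <;>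
      simp [h, h.ne, h.ne', h.not_gt, h1, h2] <;> ring
  · subst h
    have h2 : flip i (flip i S) = S := (flip i).left_inv S
    have h3 : sgn i S * (sgn i S * ψ S) = ψ S := by
      rw [← mul_assoc, sgn, ← mul_pow]; simp
    by_cases h1 : i ∈ S <;> simp [h1, h2, h3]
  · by_cases h1 : i ∈ S <;> by_cases h2 : j ∈ S <;>
      simp [h, h.ne, h.ne', h.not_gt, h1, h2] <;> ring

variable (K) in
theorem dense_lc : DenseRange (Finsupp.linearCombination ℂ (basis K)) := by
  rw [DenseRange, ← LinearMap.coe_range, Finsupp.range_linearCombination]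
  exact Submodule.dense_iff_topologicalClosure_eq_top.2 (basis K).dense_span

theorem adjoint_lc (x y : Idx K →₀ ℂ) :
    ContinuousLinearMap.adjoint (Finsupp.linearCombination ℂ modeCreate x) *
        Finsupp.linearCombination ℂ modeCreate y +
      Finsupp.linearCombination ℂ modeCreate y *
        ContinuousLinearMap.adjoint (Finsupp.linearCombination ℂ modeCreate x) =
      (⟪Finsupp.linearCombination ℂ (basis K) x, Finsupp.linearCombination ℂ (basis K) y⟫_ℂ) •
        (1 : Op K) := by
  induction x using Finsupp.induction_linear with
  | zero => simp
  | add x x' hx hx' =>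
    simp only [map_add, inner_add_left, add_smul, ← hx, ← hx', add_mul, mul_add]; abel
  | single i a =>
    induction y using Finsupp.induction_linear with
    | zero => simp
    | add y y' hy hy' =>
      simp only [map_add, inner_add_right, add_smul, ← hy, ← hy', add_mul, mul_add]; abel
    | single j b =>
      have h := annih_create i j
      simp only [Finsupp.linearCombination_single, map_smulₛₗ, adjoint_modeCreate,
        smul_mul_smul_comm, inner_smul_left, inner_smul_right,
        orthonormal_iff_ite.1 (basis K).orthonormal i j]
      rw [mul_comm b, ← smul_add, h]
      split_ifs <;> simp [mul_comm]

theorem norm_lc (x : Idx K →₀ ℂ) :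
    ‖Finsupp.linearCombination ℂ (modeCreate (K := K)) x‖ ≤
      1 * ‖Finsupp.linearCombination ℂ (basis K) x‖ := by
  set A := Finsupp.linearCombination ℂ (modeCreate (K := K)) x with hA
  rw [one_mul]
  refine ContinuousLinearMap.opNorm_le_bound _ (norm_nonneg _) fun ψ => ?_
  have h := congrArg (fun T : Op K => (⟪ψ, T ψ⟫_ℂ).re) (adjoint_lc x x)
  simp only [← hA, add_apply, mul_apply_eq_comp, inner_add_right,
    ContinuousLinearMap.adjoint_inner_right, smul_apply, one_apply_eq_self, inner_smul_right,
    inner_self_eq_norm_sq_to_K] at h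
  rw [← ContinuousLinearMap.adjoint_inner_left, inner_self_eq_norm_sq_to_K] at h
  norm_cast at h
  have h : ‖A ψ‖ ^ 2 + ‖ContinuousLinearMap.adjoint A ψ‖ ^ 2 =
      ‖Finsupp.linearCombination ℂ (basis K) x‖ ^ 2 * ‖ψ‖ ^ 2 := h
  rw [← sq_le_sq₀ (norm_nonneg _) (by positivity), mul_pow]
  nlinarith [sq_nonneg ‖ContinuousLinearMap.adjoint A ψ‖]

theorem create_lc (x : Idx K →₀ ℂ) :
    create K (Finsupp.linearCombination ℂ (basis K) x) =
      Finsupp.linearCombination ℂ modeCreate x :=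
  LinearMap.extendOfNorm_eq (dense_lc K) ⟨1, norm_lc⟩ x

/-- `c*(f) c*(h) + c*(h) c*(f) = 0`. -/
theorem create_anticomm (f h : K) : create K f * create K h + create K h * create K f = 0 := by
  refine (dense_lc K).induction_on₂ (p := fun f h =>
    create K f * create K h + create K h * create K f = 0) ?_ ?_ f h
  · exact isClosed_eq (by fun_prop) continuous_const
  · intro x y
    simp only [create_lc]
    induction x using Finsupp.induction_linear with
    | zero => simp
    | add x x' hx hx' =>
      simp only [map_add, add_mul, mul_add]
      rw [add_add_add_comm, hx, hx', add_zero]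
    | single i a =>
      induction y using Finsupp.induction_linear with
      | zero => simp
      | add y y' hy hy' =>
        simp only [map_add, add_mul, mul_add]
        rw [add_add_add_comm, hy, hy', add_zero]
      | single j b =>
        simp only [Finsupp.linearCombination_single, smul_mul_smul_comm]
        rw [mul_comm b, ← smul_add, create_create, smul_zero]

/-- `c(f) c*(h) + c*(h) c(f) = ⟪f, h⟫ 1`. -/
theorem annih_create_anticomm (f h : K) :
    ContinuousLinearMap.adjoint (create K f) * create K h +
      create K h * ContinuousLinearMap.adjoint (create K f) = ⟪f, h⟫_ℂ • (1 : Op K) := by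
  refine (dense_lc K).induction_on₂ (p := fun f h =>
    ContinuousLinearMap.adjoint (create K f) * create K h +
      create K h * ContinuousLinearMap.adjoint (create K f) = ⟪f, h⟫_ℂ • (1 : Op K)) ?_ ?_ f h
  · have hc : Continuous fun T : Op K => ContinuousLinearMap.adjoint T :=
      ContinuousLinearMap.adjoint.continuous
    have h1 : Continuous fun q : K × K => ContinuousLinearMap.adjoint (create K q.1) :=
      hc.comp (by fun_prop)
    exact isClosed_eq (by fun_prop) (by fun_prop)
  · intro x y
    simp only [create_lc]
    exact adjoint_lc x y

/-- The self-dual fermion field `B(f) = (c*(f) + c(J f)) / √2` on the antisymmetric Fock space over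
`K`, for a complex conjugation `J` of `K`. -/
noncomputable def field (J : K →ₗ⋆[ℂ] K) : K →ₗ[ℂ] Op K where
  toFun f := ((√2 : ℝ) : ℂ)⁻¹ • (create K f + ContinuousLinearMap.adjoint (create K (J f)))
  map_add' f h := by simp only [map_add, ← smul_add]; congr 1; abel
  map_smul' c f := by
    simp only [map_smulₛₗ, RingHomCompTriple.comp_apply, RingHom.id_apply, ← smul_add]
    rw [smul_comm]

/-- `B(f)* = B(J f)`. -/
theorem field_adjoint (J : K →ₗ⋆[ℂ] K) (hJ : ∀ f, J (J f) = f) (f : K) :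
    star (field J f) = field J (J f) := by
  simp [field, ContinuousLinearMap.star_eq_adjoint, hJ, add_comm]

/-- `B(f) B(h) + B(h) B(f) = ⟪J f, h⟫ 1`. -/
theorem field_anticomm (J : K →ₗ⋆[ℂ] K) (hJ : ∀ f h, ⟪J f, h⟫_ℂ = ⟪J h, f⟫_ℂ) (f h : K) :
    field J f * field J h + field J h * field J f = ⟪J f, h⟫_ℂ • (1 : Op K) := by
  have h1 := create_anticomm f h
  have h2 := annih_create_anticomm (J f) h
  have h3 := annih_create_anticomm (J h) f
  have h4 := congrArg ContinuousLinearMap.adjoint (create_anticomm (J h) (J f))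
  simp only [← ContinuousLinearMap.star_eq_adjoint, star_add, star_mul, star_zero] at h2 h3 h4
  have h5 : (((√2 : ℝ) : ℂ)⁻¹ * ((√2 : ℝ) : ℂ)⁻¹) = 2⁻¹ := by
    rw [← mul_inv, ← Complex.ofReal_mul, Real.mul_self_sqrt (by norm_num)]; simp
  simp only [field, LinearMap.coe_mk, AddHom.coe_mk, smul_mul_smul_comm, h5, ← smul_add,
    ← ContinuousLinearMap.star_eq_adjoint]
  rw [inv_smul_eq_iff₀ two_ne_zero, two_smul]
  have h6 : ∀ C D E F X : Op K, C * E + E * C = 0 → D * E + E * D = X → F * C + C * F = X →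
      D * F + F * D = 0 → (C + D) * (E + F) + (E + F) * (C + D) = X + X := by
    intro C D E F X e1 e2 e3 e4
    calc _ = (C * E + E * C) + (D * E + E * D) + (F * C + C * F) + (D * F + F * D) := by
          noncomm_ring
      _ = _ := by rw [e1, e2, e3, e4]; simp
  exact h6 _ _ _ _ _ h1 h2 (by rw [h3, hJ f h]) h4

/-- The CAR algebra over `(K, J)`: the C*-algebra generated by the operators `B(f)`, `f ∈ K`. -/
noncomputable def algebra (J : K →ₗ⋆[ℂ] K) : StarSubalgebra ℂ (Op K) :=
  (StarAlgebra.adjoin ℂ (Set.range (field J))).topologicalClosure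

end Fock
end CAR

/-- The data of the theory: a complex conjugation `J` (an antiunitary involution) of a complex
Hilbert space `H` and an orthogonal projection `Q` that commutes with `J`. -/
structure GARTriple (H : Type*) [NormedAddCommGroup H] [InnerProductSpace ℂ H]
    [CompleteSpace H] where
  /-- the complex conjugation -/
  J : H ≃ₗᵢ⋆[ℂ] H
  J_J : ∀ f, J (J f) = f
  /-- the projection -/
  Q : H →L[ℂ] H
  isStarProjection : IsStarProjection Q
  Q_J : ∀ f, Q (J f) = J (Q f)

namespace GARTriple

open scoped TensorProduct

variable {H : Type*} [NormedAddCommGroup H] [InnerProductSpace ℂ H] [CompleteSpace H]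
  (T : GARTriple H)

/-- The subspace `QH`. -/
abbrev QH : Submodule ℂ H := LinearMap.range (T.Q : H →ₗ[ℂ] H)

/-- The subspace `Q^⊥ H`, where `Q^⊥ = 1 - Q`; for a projection `Q` it is the kernel of `Q`. -/
abbrev QperpH : Submodule ℂ H := LinearMap.ker (T.Q : H →ₗ[ℂ] H)

theorem Q_Q (f : H) : T.Q (T.Q f) = T.Q f :=
  congrArg (fun A : H →L[ℂ] H => A f) T.isStarProjection.isIdempotentElem

/-- The map `Q^⊥` from `H` onto `Q^⊥ H`. -/
noncomputable def projPerp : H →ₗ[ℂ] T.QperpH :=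
  LinearMap.codRestrict T.QperpH (LinearMap.id - (T.Q : H →ₗ[ℂ] H))
    (fun f => by simp [T.Q_Q f])

/-- The Hilbert space `H_Q = H ⊕ Q^⊥ H`. -/
abbrev HQ : Type _ := WithLp 2 (H × T.QperpH)

/-- The conjugation `J_Q (f ⊕ h) = (Q J f + J h) ⊕ Q^⊥ J f` of `H_Q`, that is,
`J_Q = R_Q (J ⊕ Q^⊥ J)` with the reflection `R_Q (f ⊕ h) = (Q f + h) ⊕ Q^⊥ f`. -/
noncomputable def JQ : T.HQ →ₗ⋆[ℂ] T.HQ where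
  toFun x := WithLp.toLp 2 (T.Q (T.J x.fst) + T.J x.snd, T.projPerp (T.J x.fst))
  map_add' x y := by
    refine WithLp.ofLp_injective 2 (Prod.ext ?_ ?_)
    · simp; abel
    · simp
  map_smul' c x := by
    refine WithLp.ofLp_injective 2 (Prod.ext ?_ ?_) <;> simp [map_smulₛₗ]

theorem inner_J_J (f h : H) : ⟪T.J f, T.J h⟫_ℂ = ⟪h, f⟫_ℂ := by
  have hI : T.J (Complex.I • h) = -(Complex.I • T.J h) := by simp [map_smulₛₗ]
  have e1 : ‖T.J f + T.J h‖ = ‖f + h‖ := by rw [← map_add, LinearIsometryEquiv.norm_map]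
  have e2 : ‖T.J f - T.J h‖ = ‖f - h‖ := by rw [← map_sub, LinearIsometryEquiv.norm_map]
  have e3 : ‖T.J f - Complex.I • T.J h‖ = ‖f + Complex.I • h‖ := by
    rw [sub_eq_add_neg, ← hI, ← map_add, LinearIsometryEquiv.norm_map]
  have e4 : ‖T.J f + Complex.I • T.J h‖ = ‖f - Complex.I • h‖ := by
    rw [← neg_neg (Complex.I • T.J h), ← hI, ← sub_eq_add_neg, ← map_sub,
      LinearIsometryEquiv.norm_map]
  rw [← inner_conj_symm h f, inner_eq_sum_norm_sq_div_four (T.J f),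
    inner_eq_sum_norm_sq_div_four f]
  have h4 : conj (4 : ℂ) = 4 := Complex.conj_ofNat 4
  simp only [RCLike.I_to_complex, e1, e2, e3, e4]
  simp [h4]
  ring

theorem inner_J_left (f h : H) : ⟪T.J f, h⟫_ℂ = ⟪T.J h, f⟫_ℂ := by
  rw [← T.inner_J_J h (T.J f), T.J_J]

theorem JQ_JQ (x : T.HQ) : T.JQ (T.JQ x) = x := by
  have h2 : T.Q (x.snd : H) = 0 := x.snd.2
  refine WithLp.ofLp_injective 2 (Prod.ext ?_ (Subtype.ext ?_))
  · simp [JQ, projPerp, T.J_J, T.Q_J, T.Q_Q, h2]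
  · simp [JQ, projPerp, T.J_J, T.Q_J, T.Q_Q, h2]

theorem inner_JQ_left (x y : T.HQ) : ⟪T.JQ x, y⟫_ℂ = ⟪T.JQ y, x⟫_ℂ := by
  have hQ (f h : H) : ⟪T.Q f, h⟫_ℂ = ⟪f, T.Q h⟫_ℂ := by
    conv_lhs => rw [← T.isStarProjection.isSelfAdjoint.star_eq]
    exact ContinuousLinearMap.adjoint_inner_left _ _ _
  have h2 (x : T.HQ) : T.Q (x.snd : H) = 0 := x.snd.2
  simp [JQ, projPerp, WithLp.prod_inner_apply, inner_add_left, inner_sub_left, hQ, h2]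
  rw [T.inner_J_left x.fst (T.Q y.fst), ← T.Q_J, hQ, T.inner_J_left x.fst,
    T.inner_J_left (x.snd : H)]
  ring

/-- The enveloping CAR algebra `CAR(H_Q, J_Q)`. -/
noncomputable def envelope : StarSubalgebra ℂ (CAR.Op T.HQ) := CAR.algebra T.JQ

/-- The GAR algebra: the norm-closed unital subalgebra of the enveloping CAR algebra that is
generated by the operators `B(f ⊕ 0)`, `f ∈ H`. -/
noncomputable def gar : Subalgebra ℂ (CAR.Op T.HQ) :=
  (Algebra.adjoin ℂ (Set.range fun f : H => CAR.field T.JQ (WithLp.toLp 2 (f, 0)))).topologicalClosure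

theorem gar_le_envelope : T.gar ≤ T.envelope.toSubalgebra := by
  refine Subalgebra.topologicalClosure_minimal (Algebra.adjoin_le ?_)
    (StarSubalgebra.isClosed_topologicalClosure _)
  rintro _ ⟨f, rfl⟩
  exact StarSubalgebra.le_topologicalClosure _ (StarAlgebra.subset_adjoin ℂ _ ⟨_, rfl⟩)

/-- The GAR algebra as a type; it is a Banach algebra with the operator norm. -/
def Gar : Type _ := ↥T.gar

noncomputable instance : NormedRing T.Gar := inferInstanceAs (NormedRing ↥T.gar)

noncomputable instance : NormedAlgebra ℂ T.Gar := inferInstanceAs (NormedAlgebra ℂ ↥T.gar)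

instance : CompleteSpace T.Gar :=
  (Subalgebra.isClosed_topologicalClosure _).completeSpace_coe

/-- The Grassmann-Fermi field operators `G(f) = B(f ⊕ 0)`. -/
noncomputable def G : H →ₗ[ℂ] T.Gar :=
  LinearMap.codRestrict (Subalgebra.toSubmodule T.gar)
    (CAR.field T.JQ ∘ₗ (WithLp.linearEquiv 2 ℂ (H × T.QperpH)).symm.toLinearMap ∘ₗ
      LinearMap.inl ℂ H T.QperpH)
    (fun f => Subalgebra.le_topologicalClosure _ (Algebra.subset_adjoin ⟨f, rfl⟩))

/-- `G(f) G(h) + G(h) G(f) = ⟪J f, Q h⟫ 1`. -/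
theorem G_anticomm (f h : H) :
    T.G f * T.G h + T.G h * T.G f = ⟪T.J f, T.Q h⟫_ℂ • (1 : T.Gar) := by
  refine Subtype.ext ((CAR.field_anticomm T.JQ T.inner_JQ_left (WithLp.toLp 2 (f, 0))
    (WithLp.toLp 2 (h, 0))).trans ?_)
  have hQ : ⟪T.Q (T.J f), h⟫_ℂ = ⟪T.J f, T.Q h⟫_ℂ := by
    conv_lhs => rw [← T.isStarProjection.isSelfAdjoint.star_eq]
    exact ContinuousLinearMap.adjoint_inner_left _ _ _
  simp [JQ, WithLp.prod_inner_apply, hQ]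
  rfl

/-- The Grassmann part: the norm-closed unital subalgebra generated by `G(f)`, `f ∈ Q^⊥ H`. -/
noncomputable def grass : Subalgebra ℂ T.Gar :=
  (Algebra.adjoin ℂ (Set.range fun f : T.QperpH => T.G f)).topologicalClosure

/-- The odd part of the Grassmann part: the closed linear span of the products of an odd number of
generators `G(f)`, `f ∈ Q^⊥ H`. -/
noncomputable def odd : Submodule ℂ T.Gar :=
  (Submodule.span ℂ {a | ∃ l : List T.QperpH, Odd l.length ∧
    a = (l.map fun f => T.G f).prod}).topologicalClosure

/-- The even part of the anticommutative phase space: `QH ⊗ (odd Grassmann operators)`. Only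
finite rank projections `Q` are used, so that the algebraic tensor product is already complete. -/
abbrev Phase : Type _ := T.QH ⊗[ℂ] T.odd

/-- The `u`-component `ξ_u = ⟪⟪u ⊗ 1, ξ⟫⟫` of `ξ`, determined by `(f ⊗ λ)_u = ⟪u, f⟫ λ`. -/
noncomputable def comp (u : H) : T.Phase →ₗ[ℂ] T.Gar :=
  TensorProduct.lift (LinearMap.compl₁₂ (LinearMap.lsmul ℂ T.Gar)
    ((innerₛₗ ℂ u) ∘ₗ T.QH.subtype) T.odd.subtype)

@[simp] theorem comp_tmul (u : H) (f : T.QH) (l : T.odd) :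
    T.comp u (f ⊗ₜ l) = ⟪u, (f : H)⟫_ℂ • (l : T.Gar) := by
  simp [comp]

theorem comp_add (u u' : H) : T.comp (u + u') = T.comp u + T.comp u' := by
  ext f l : 3; simp [add_smul]

theorem comp_smul (c : ℂ) (u : H) : T.comp (c • u) = conj c • T.comp u := by
  ext f l : 3; simp [mul_smul, smul_comm (conj c)]

/-- The Grassmann-valued symplectic form `(ξ, η) ↦ ⟪⟪ξ⋆, η⟫⟫` on the even phase space, where
`⟪⟪f ⊗ λ, h ⊗ μ⟫⟫ = ⟪f, h⟫ λ⋆ μ` is the rigging map, and where `ξ⋆` is the adjoint of `ξ` in the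
ambient Grassmann algebra, in which `f ⊗ λ` is `Λ(f) λ`: for an odd `λ` this is
`(f ⊗ λ)⋆ = λ⋆ Λ(J f) = - Λ(J f) λ⋆ = - J f ⊗ λ⋆`. Hence the form is determined by
`⟪⟪(f ⊗ λ)⋆, h ⊗ μ⟫⟫ = - ⟪J f, h⟫ λ μ`. -/
noncomputable def symp : T.Phase →ₗ[ℂ] T.Phase →ₗ[ℂ] T.Gar :=
  TensorProduct.lift (LinearMap.mk₂ ℂ
    (fun (f : T.QH) (l : T.odd) => -(LinearMap.mulLeft ℂ (l : T.Gar) ∘ₗ T.comp (T.J f)))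
    (fun f f' l => by
      ext h m : 3; simp [comp_add, mul_add]; abel)
    (fun c f l => by
      ext h m : 3; simp [map_smulₛₗ, comp_smul])
    (fun f l l' => by
      ext h m : 3; simp [add_mul]; abel)
    (fun c f l => by
      ext h m : 3; simp [smul_comm c]))

theorem symp_tmul (f h : T.QH) (l m : T.odd) :
    T.symp (f ⊗ₜ l) (h ⊗ₜ m) = -(⟪T.J f, (h : H)⟫_ℂ • ((l : T.Gar) * (m : T.Gar))) := by
  simp [symp]

/-- The Grassmann-Bose field, determined by `Φ(f ⊗ λ) = G(f) λ`. -/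
noncomputable def bose : T.Phase →ₗ[ℂ] T.Gar :=
  TensorProduct.lift (LinearMap.compl₁₂ (LinearMap.mul ℂ T.Gar)
    (T.G ∘ₗ T.QH.subtype) T.odd.subtype)

/-- The Grassmann-Weyl operators `w(ξ) = exp Φ(ξ)`. -/
noncomputable def weyl (ξ : T.Phase) : T.Gar := NormedSpace.exp (T.bose ξ)

/-- The phase space translations `α_ξ(A) = w(-ξ) A w(ξ)`. -/
noncomputable def translate (ξ : T.Phase) (A : T.Gar) : T.Gar := T.weyl (-ξ) * A * T.weyl ξ

/-- The G-holomorphic functions with values in `M` (for us `M` is the Grassmann part or the whole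
GAR algebra): the linear span of the monomials `ξ ↦ X ξ_{u₁} ⋯ ξ_{uₖ}` with `X ∈ M` and
`u₁, …, uₖ ∈ QH`. -/
noncomputable def gHol (M : Submodule ℂ T.Gar) : Submodule ℂ (T.Phase → T.Gar) :=
  Submodule.span ℂ {F | ∃ X ∈ M, ∃ l : List T.QH,
    F = fun ξ => X * (l.map fun u => T.comp u ξ).prod}

/-- The algebra of Grassmann-valued G-holomorphic functions. -/
noncomputable def hol : Submodule ℂ (T.Phase → T.Gar) := T.gHol (Subalgebra.toSubmodule T.grass)

section Integral

variable {T} {n : ℕ} (e : OrthonormalBasis (Fin (2 * n)) ℂ T.QH) (v : ⋀[ℂ]^(2 * n) T.QH)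

/-- The monomial `ξ_I = ξ_{i₁} ⋯ ξ_{iₖ}` for `I = {i₁ < ⋯ < iₖ}`, where `ξ_i` is the `i`-th
component of `ξ = ∑ eⁱ ⊗ ξ_i`. -/
noncomputable def monomial (I : Finset (Fin (2 * n))) (ξ : T.Phase) : T.Gar :=
  ((I.sort (· ≤ ·)).map fun i => T.comp (e i) ξ).prod

/-- `F(ξ) = ∑_I F^I ξ_I` is a polynomial representation of `F` with coefficients `F^I = c I`. -/
def IsPolyRep (F : T.Phase → T.Gar) (c : Finset (Fin (2 * n)) → T.Gar) : Prop :=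
  ∀ ξ, F ξ = ∑ I, c I * monomial e I ξ

/-- The coefficient `v_N` of `v = v_N e¹ ∧ ⋯ ∧ e²ⁿ`. -/
noncomputable def topCoord : ℂ :=
  exteriorPower.alternatingMapLinearEquiv e.toBasis.det v

open Classical in
/-- The Grassmann integral `∫_Q v(ξ) F(ξ) = v_N F^N`, where `F(ξ) = ∑_I F^I ξ_I` is a polynomial
representation and `N` is the full index set. (If `Q^⊥` has infinite rank, then `F^N` is unique.
Functions without a polynomial representation get the value `0`.) -/
noncomputable def integral (F : T.Phase → T.Gar) : T.Gar :=
  if h : ∃ c, IsPolyRep e F c then topCoord e v • h.choose Finset.univ else 0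

/-- Convolution of two functions, `(f ∗ f')(ξ) = ∫_Q v(η) f(η) f'(ξ - η)`. -/
noncomputable def convFun (f f' : T.Phase → T.Gar) (ξ : T.Phase) : T.Gar :=
  integral e v fun η => f η * f' (ξ - η)

/-- Convolution of an operator and a function, `A ∗ f = ∫_Q v(η) α_{εη}(A) f(η)`, for a sign `ε`. -/
noncomputable def convOpFun (ε : ℤˣ) (A : T.Gar) (f : T.Phase → T.Gar) : T.Gar :=
  integral e v fun η => T.translate ((ε : ℤ) • η) A * f η

/-- Fourier transform of a function, `(F f)(ξ) = ∫_Q v(η) f(η) exp(ε ⟪⟪ξ⋆, η⟫⟫)`, for a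
sign `ε`. -/
noncomputable def fourierFun (ε : ℤˣ) (f : T.Phase → T.Gar) (ξ : T.Phase) : T.Gar :=
  integral e v fun η => f η * NormedSpace.exp ((ε : ℤ) • T.symp ξ η)

/-- Fourier transform of an operator,
`(F A)(ξ) = w(-ξ) ∫_Q v(η) α_{-η}(A) exp(⟪⟪ξ⋆, η⟫⟫)`. -/
noncomputable def fourierOp (A : T.Gar) (ξ : T.Phase) : T.Gar :=
  T.weyl (-ξ) * integral e v fun η => T.translate (-η) A * NormedSpace.exp (T.symp ξ η)

end Integral

/-- Right module homomorphisms from the GAR algebra into its Grassmann part. -/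
def IsRightModuleHom (φ : T.Gar →L[ℂ] T.grass) : Prop :=
  ∀ (A : T.Gar) (l : T.grass), φ (A * l) = φ A * l

variable {T}

/-- Convolution of a right module homomorphism and an operator,
`(φ ∗ A)(ξ) = φ(α_{-εξ}(A))`, for a sign `ε`. -/
noncomputable def convHomOp (ε : ℤˣ) (φ : T.Gar →L[ℂ] T.grass) (A : T.Gar) (ξ : T.Phase) :
    T.Gar :=
  φ (T.translate (-((ε : ℤ) • ξ)) A)

/-- Fourier transform of a right module homomorphism, `(F φ)(ξ) = φ(w(ξ))`. -/
noncomputable def fourierHom (φ : T.Gar →L[ℂ] T.grass) (ξ : T.Phase) : T.Gar :=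
  φ (T.weyl ξ)

end GARTriple

/-! The integral only reads off the top coefficient of a Grassmann polynomial, so the theorem is
algebra with signs, resting on two facts. Odd Grassmann elements λ satisfy λ A = `par` A · λ for
every A of the GAR algebra (`odd_mul`); here `par` is conjugation by (-1)^N on Fock space, whose
continuity carries sign rules from generators to norm closures. And coefficients of polynomials are
unique (`IsPolyRep.eq_zero`): if c G(h) = 0 for all h in Q^⊥H, then c = 0 (`eq_zero_of_mul_G`).
Indeed an element built from finitely many modes commutes up to parity with G(h)* for a unit h
orthogonal to these modes, and the anticommutation relation recovers it from its products with G(h).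
The infinite rank of Q^⊥ supplies h.

Consequently the integral is linear over the GAR algebra on both sides (2n is even), commutes with
right module maps, obeys Fubini's theorem (`integral_comm`) and is invariant under η ↦ ±η + ζ
(`integral_affine`). The exponentials w(ξ) and e^{σ(ξ,η)} are finite products of factors 1 + x with
x² = 0, hence polynomials. The translations α_ζ are automorphisms that fix Λ and send G(e_i) to
G(e_i) + ζ_i (`translate_G_basis`), whence α_ξ α_η = α_{ξ+η} and α_ζ(w(ξ)) = w(ξ) e^{σ(ξ,ζ)}
(`translate_weyl`).

The least formal point is that F A is Λ-valued. By the last relation, F A(ξ) is the average ∫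
α_{-η}(w(-ξ) A) over all translations (`fourierOp_eq`). Averaging λ G(e_{i₁}) ⋯ G(e_{iₖ}) with
distinct indices keeps only the top degree in η, which leaves a scalar multiple of λ; such products
span a dense subspace, and the average is continuous (`average_mem_grass`).

The identities are then the classical computation: exchange the integrals, shift the variable, use
that e^{σ(ξ,·)} is a central character. For a module homomorphism φ, the integral moves inside φ and
becomes φ(w(ξ) F A(ξ)) = φ(w(ξ)) F A(ξ). -/

namespace CAR

/-! ### Parity on Fock space -/

section Parity

variable {K : Type*} [NormedAddCommGroup K] [InnerProductSpace ℂ K] [CompleteSpace K]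

theorem parity_memℓp (ψ : Fock K) :
    Memℓp (fun S : Finset (Idx K) => (-1 : ℂ) ^ S.card * ψ S) 2 := by
  refine memℓp_gen ?_
  simpa using summable_sq ψ

variable (K) in
/-- The parity operator `(-1)^N`, where `N` is the particle number operator. -/
noncomputable def parity : Op K :=
  LinearMap.mkContinuous
    { toFun := fun ψ => (⟨fun S => (-1) ^ S.card * ψ S, parity_memℓp ψ⟩ : Fock K)
      map_add' := fun ψ φ => by
        ext S; exact mul_add _ (ψ S) (φ S)
      map_smul' := fun c ψ => by
        ext S; exact mul_left_comm _ c (ψ S) }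
    1 (fun ψ => by
      rw [one_mul, ← sq_le_sq₀ (norm_nonneg _) (norm_nonneg _), norm_sq, norm_sq]
      refine le_of_eq (tsum_congr fun S => ?_)
      change ‖(-1 : ℂ) ^ S.card * ψ S‖ ^ 2 = _
      simp)

@[simp] theorem parity_apply (ψ : Fock K) (S : Finset (Idx K)) :
    parity K ψ S = (-1) ^ S.card * ψ S := rfl

theorem parity_mul_parity : parity K * parity K = 1 := by
  ext ψ S
  simp only [mul_apply_eq_comp, parity_apply, one_apply_eq_self]
  rw [← mul_assoc, ← mul_pow]; simp

theorem star_parity : star (parity K) = parity K := by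
  rw [ContinuousLinearMap.star_eq_adjoint]
  symm
  rw [ContinuousLinearMap.eq_adjoint_iff]
  intro ψ φ
  rw [lp.inner_eq_tsum, lp.inner_eq_tsum]
  refine tsum_congr fun S => ?_
  simp [mul_left_comm, mul_comm, mul_assoc]

theorem neg_one_pow_card_flip (i : Idx K) (S : Finset (Idx K)) :
    (-1 : ℂ) ^ (flip i S).card = -(-1) ^ S.card := by
  by_cases h : i ∈ S
  · rw [flip_of_mem h, ← Finset.card_erase_add_one h, pow_succ]; simp
  · rw [flip_of_notMem h, Finset.card_insert_of_notMem h, pow_succ]; simp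

theorem parity_modeCreate (i : Idx K) :
    parity K * modeCreate i + modeCreate i * parity K = 0 := by
  ext ψ S
  simp only [add_apply, mul_apply_eq_comp, lp.coeFn_add, Pi.add_apply, parity_apply, modeCreate,
    shift_apply, neg_one_pow_card_flip]
  simp only [zero_apply, lp.coeFn_zero, Pi.zero_apply]
  ring

theorem parity_create (f : K) : parity K * create K f + create K f * parity K = 0 := by
  refine (dense_lc K).induction_on (p := fun f =>
    parity K * create K f + create K f * parity K = 0) f ?_ ?_
  · exact isClosed_eq ((continuous_const.mul (create K).continuous).add
      ((create K).continuous.mul continuous_const)) continuous_const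
  · intro x
    simp only [create_lc]
    induction x using Finsupp.induction_linear with
    | zero => simp
    | add x x' hx hx' =>
      simp only [map_add, add_mul, mul_add]
      rw [add_add_add_comm, hx, hx', add_zero]
    | single i a =>
      simp only [Finsupp.linearCombination_single, mul_smul_comm, smul_mul_assoc]
      rw [← smul_add, parity_modeCreate, smul_zero]

/-- The annihilation half follows from the creation half by taking adjoints, since the parity
operator is self-adjoint. -/
theorem parity_field (J : K →ₗ⋆[ℂ] K) (f : K) :
    parity K * field J f = -(field J f * parity K) := by
  have h1 := parity_create f
  have h2 := congrArg star (parity_create (J f))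
  simp only [star_add, star_mul, star_zero, star_parity] at h2
  rw [eq_neg_iff_add_eq_zero]
  simp only [field, LinearMap.coe_mk, AddHom.coe_mk, mul_smul_comm, smul_mul_assoc, ← smul_add,
    ← ContinuousLinearMap.star_eq_adjoint, mul_add, add_mul]
  rw [add_add_add_comm, h1, zero_add, add_comm, h2, smul_zero]

variable (K) in
/-- The parity automorphism of the operators on Fock space. -/
noncomputable def grading : Op K →ₐ[ℂ] Op K where
  toFun A := parity K * A * parity K
  map_one' := by rw [mul_one, parity_mul_parity]
  map_mul' A B := by
    rw [show parity K * A * parity K * (parity K * B * parity K) =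
      parity K * A * (parity K * parity K) * B * parity K by simp only [mul_assoc],
      parity_mul_parity]
    simp only [mul_assoc, mul_one]
  map_zero' := by simp
  map_add' A B := by simp only [mul_add, add_mul]
  commutes' c := by
    rw [Algebra.algebraMap_eq_smul_one, mul_smul_comm, smul_mul_assoc, mul_one, parity_mul_parity]

theorem grading_apply (A : Op K) : grading K A = parity K * A * parity K := rfl

theorem grading_grading (A : Op K) : grading K (grading K A) = A := by
  rw [grading_apply, grading_apply, show parity K * (parity K * A * parity K) * parity K =
    parity K * parity K * A * (parity K * parity K) by simp only [mul_assoc], parity_mul_parity,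
    one_mul, mul_one]

theorem continuous_grading : Continuous (grading K) := by
  exact (continuous_const.mul continuous_id).mul continuous_const

theorem grading_field (J : K →ₗ⋆[ℂ] K) (f : K) : grading K (field J f) = -field J f := by
  rw [grading_apply, parity_field, neg_mul, mul_assoc, parity_mul_parity, mul_one]

theorem norm_parity_le : ‖parity K‖ ≤ 1 := LinearMap.mkContinuous_norm_le _ zero_le_one _

theorem norm_grading_le (A : Op K) : ‖grading K A‖ ≤ ‖A‖ := by
  rw [grading_apply]
  calc ‖parity K * A * parity K‖ ≤ ‖parity K‖ * ‖A‖ * ‖parity K‖ :=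
        (norm_mul_le _ _).trans (mul_le_mul_of_nonneg_right (norm_mul_le _ _) (norm_nonneg _))
    _ ≤ 1 * ‖A‖ * 1 := by
        gcongr <;> exact norm_parity_le
    _ = ‖A‖ := by ring

/-- An operator `a` with `a* a + a a* = 1` is a contraction. -/
theorem norm_le_one_of_car {a : Op K} (h : star a * a + a * star a = 1) : ‖a‖ ≤ 1 := by
  refine ContinuousLinearMap.opNorm_le_bound _ zero_le_one fun ψ => ?_
  have h := congrArg (fun T : Op K => (⟪ψ, T ψ⟫_ℂ).re) h
  simp only [ContinuousLinearMap.star_eq_adjoint, add_apply, mul_apply_eq_comp, inner_add_right,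
    ContinuousLinearMap.adjoint_inner_right, one_apply_eq_self, inner_self_eq_norm_sq_to_K] at h
  rw [← ContinuousLinearMap.adjoint_inner_left, inner_self_eq_norm_sq_to_K] at h
  norm_cast at h
  have h : ‖a ψ‖ ^ 2 + ‖ContinuousLinearMap.adjoint a ψ‖ ^ 2 = ‖ψ‖ ^ 2 := h
  rw [one_mul, ← sq_le_sq₀ (norm_nonneg _) (norm_nonneg _)]
  nlinarith [sq_nonneg ‖ContinuousLinearMap.adjoint a ψ‖]

end Parity

end CAR

namespace GARTriple

open scoped TensorProduct

/-- In the definitions of `odd` and `gHol` the list of subspace elements is coerced to a list in `H`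
as a whole, by a monadic bind. This identifies that form with the elementwise coercion. -/
theorem coe_list_map {H : Type*} [NormedAddCommGroup H] [InnerProductSpace ℂ H] {β : Type*} {S : Submodule ℂ H} (g : H → β) (l : List S) :
    (l.map fun f : S => g f) = List.map (fun f => g f) (do let a ← l; pure (a : H)) := by
  induction l with
  | nil => rfl
  | cons a l ih => simp

variable {H : Type*} [NormedAddCommGroup H] [InnerProductSpace ℂ H] [CompleteSpace H]
  (T : GARTriple H)

/-! ### Parity automorphism of the GAR algebra and sign rules -/

noncomputable instance : NormedAlgebra ℚ T.Gar := NormedAlgebra.restrictScalars ℚ ℂ T.Gar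

/-- The inclusion of the GAR algebra into the operators on Fock space. -/
noncomputable def garVal : T.Gar →ₐ[ℂ] CAR.Op T.HQ := T.gar.val

theorem garVal_injective : Function.Injective T.garVal := Subtype.val_injective

theorem norm_garVal (A : T.Gar) : ‖T.garVal A‖ = ‖A‖ := rfl

theorem isInducing_garVal : Topology.IsInducing T.garVal := Topology.IsInducing.subtypeVal

theorem garVal_G (f : H) : T.garVal (T.G f) = CAR.field T.JQ (WithLp.toLp 2 (f, 0)) := rfl

theorem garVal_mem (A : T.Gar) : T.garVal A ∈ T.gar := A.2

/-- The GAR algebra is a closure taken inside the operators on Fock space; the induced topology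
turns this into density within the type `Gar`, which is what the closed-property inductions need. -/
theorem dense_adjoin_G :
    Dense ((Algebra.adjoin ℂ (Set.range T.G) : Subalgebra ℂ T.Gar) : Set T.Gar) := by
  intro A
  rw [T.isInducing_garVal.closure_eq_preimage_closure_image, Set.mem_preimage,
    ← Subalgebra.coe_map, AlgHom.map_adjoin, ← Set.range_comp]
  exact T.garVal_mem A

/-- Induction principle for closed properties of the GAR algebra. -/
theorem gar_induction {p : T.Gar → Prop} (hc : IsClosed {A | p A})
    (hscalar : ∀ c : ℂ, p (algebraMap ℂ T.Gar c)) (hG : ∀ f, p (T.G f))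
    (hadd : ∀ A B, p A → p B → p (A + B)) (hmul : ∀ A B, p A → p B → p (A * B)) (A : T.Gar) :
    p A := by
  refine hc.closure_subset_iff.2 ?_ (T.dense_adjoin_G A)
  intro A hA
  induction hA using Algebra.adjoin_induction with
  | mem x hx => obtain ⟨f, rfl⟩ := hx; exact hG f
  | algebraMap c => exact hscalar c
  | add x y _ _ hx hy => exact hadd _ _ hx hy
  | mul x y _ _ hx hy => exact hmul _ _ hx hy

theorem grading_mem_gar (A : T.Gar) : CAR.grading T.HQ (T.garVal A) ∈ T.gar := by
  refine T.gar_induction (p := fun A => CAR.grading T.HQ (T.garVal A) ∈ T.gar) ?_ ?_ ?_ ?_ ?_ A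
  · exact (Subalgebra.isClosed_topologicalClosure _).preimage
      (CAR.continuous_grading.comp T.isInducing_garVal.continuous)
  · intro c; rw [AlgHom.commutes, AlgHom.commutes]; exact Subalgebra.algebraMap_mem _ c
  · intro f; rw [garVal_G, CAR.grading_field, ← garVal_G, ← map_neg]; exact T.garVal_mem _
  · intro A B hA hB; rw [map_add, map_add]; exact add_mem hA hB
  · intro A B hA hB; rw [map_mul, map_mul]; exact mul_mem hA hB

/-- The parity automorphism of the GAR algebra. -/
noncomputable def par : T.Gar →ₐ[ℂ] T.Gar :=
  AlgHom.codRestrict ((CAR.grading T.HQ).comp T.garVal) T.gar T.grading_mem_gar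

theorem garVal_par (A : T.Gar) : T.garVal (T.par A) = CAR.grading T.HQ (T.garVal A) := rfl

@[simp] theorem par_par (A : T.Gar) : T.par (T.par A) = A :=
  T.garVal_injective (by rw [garVal_par, garVal_par, CAR.grading_grading])

@[simp] theorem par_G (f : H) : T.par (T.G f) = -T.G f :=
  T.garVal_injective (by rw [garVal_par, map_neg, garVal_G, CAR.grading_field])

theorem continuous_par : Continuous T.par :=
  T.isInducing_garVal.continuous_iff.2
    (CAR.continuous_grading.comp T.isInducing_garVal.continuous)

theorem norm_par_le (A : T.Gar) : ‖T.par A‖ ≤ ‖A‖ := CAR.norm_grading_le _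

/-- The anticommutator sees only the Q-components of its arguments. -/
theorem G_anticomm_perp (h : T.QperpH) (f : H) : T.G h * T.G f = -(T.G f * T.G h) := by
  rw [eq_neg_iff_add_eq_zero, add_comm, G_anticomm, show T.Q (h : H) = 0 from h.2,
    inner_zero_right, zero_smul]

/-- Both sides are continuous in `A`, and the rule is inherited by products because `par` is
multiplicative; so it suffices to know it on the generators. -/
theorem mul_eq_par_mul_aux (x : T.Gar) (hx : ∀ f, x * T.G f = -(T.G f * x)) (A : T.Gar) :
    x * A = T.par A * x := by
  have hp := T.continuous_par
  refine T.gar_induction (p := fun A => x * A = T.par A * x) ?_ ?_ ?_ ?_ ?_ A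
  · exact isClosed_eq (continuous_const.mul continuous_id) (hp.mul continuous_const)
  · intro c; rw [AlgHom.commutes]; exact (Algebra.commutes c x).symm
  · intro f; rw [hx, par_G, neg_mul]
  · intro A B hA hB; rw [mul_add, hA, hB, map_add, add_mul]
  · intro A B hA hB; rw [← mul_assoc, hA, mul_assoc, hB, map_mul, mul_assoc]

theorem G_perp_mul (h : T.QperpH) (A : T.Gar) : T.G h * A = T.par A * T.G h :=
  T.mul_eq_par_mul_aux _ (T.G_anticomm_perp h) A

/-- Induction principle for the odd part of the Grassmann algebra. -/
theorem odd_induction {p : T.Gar → Prop} (hc : IsClosed {A | p A}) (h0 : p 0)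
    (hadd : ∀ A B, p A → p B → p (A + B)) (hsmul : ∀ (c : ℂ) A, p A → p (c • A))
    (hprod : ∀ l : List T.QperpH, Odd l.length → p (l.map fun f : T.QperpH => T.G f).prod) {A : T.Gar}
    (hA : A ∈ T.odd) : p A := by
  refine hc.closure_subset_iff.2 ?_ hA
  intro A hA
  induction hA using Submodule.span_induction with
  | mem x hx =>
    obtain ⟨l, hl, rfl⟩ := hx
    have := hprod l hl
    rwa [coe_list_map (⇑T.G)] at this
  | zero => exact h0
  | add x y _ _ hx hy => exact hadd _ _ hx hy
  | smul c x _ hx => exact hsmul c x hx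

/-- Induction principle for the Grassmann algebra. -/
theorem grass_induction {p : T.Gar → Prop} (hc : IsClosed {A | p A})
    (hscalar : ∀ c : ℂ, p (algebraMap ℂ T.Gar c)) (hG : ∀ f : T.QperpH, p (T.G f))
    (hadd : ∀ A B, p A → p B → p (A + B)) (hmul : ∀ A B, p A → p B → p (A * B)) {A : T.Gar}
    (hA : A ∈ T.grass) : p A := by
  refine hc.closure_subset_iff.2 ?_ hA
  intro A hA
  induction hA using Algebra.adjoin_induction with
  | mem x hx => obtain ⟨f, rfl⟩ := hx; exact hG f
  | algebraMap c => exact hscalar c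
  | add x y _ _ hx hy => exact hadd _ _ hx hy
  | mul x y _ _ hx hy => exact hmul _ _ hx hy

theorem isClosed_grass : IsClosed (T.grass : Set T.Gar) :=
  Subalgebra.isClosed_topologicalClosure _

theorem G_mem_grass (h : T.QperpH) : T.G h ∈ T.grass :=
  Subalgebra.le_topologicalClosure _ (Algebra.subset_adjoin ⟨h, rfl⟩)

theorem G_mem_odd (h : T.QperpH) : T.G h ∈ T.odd :=
  Submodule.le_topologicalClosure _ (Submodule.subset_span ⟨[h], by simp, by simp⟩)

theorem odd_le_grass {A : T.Gar} (hA : A ∈ T.odd) : A ∈ T.grass := by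
  refine T.odd_induction (p := fun A => A ∈ T.grass) T.isClosed_grass (zero_mem _) (fun _ _ => add_mem)
    (fun c A hA => Subalgebra.smul_mem _ hA c) (fun l _ => list_prod_mem ?_) hA
  simp only [List.mem_map]
  rintro _ ⟨f, _, rfl⟩
  exact T.G_mem_grass f

theorem par_odd {A : T.Gar} (hA : A ∈ T.odd) : T.par A = -A := by
  have hp := T.continuous_par
  refine T.odd_induction (p := fun A => T.par A = -A) (isClosed_eq hp continuous_neg) (by simp)
    (fun A B hA hB => by rw [map_add, hA, hB, neg_add]) (fun c A hA => by
      rw [map_smul, hA, smul_neg]) (fun l hl => ?_) hA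
  have h (l : List T.QperpH) : T.par (l.map fun f : T.QperpH => T.G f).prod =
      (-1) ^ l.length * (l.map fun f : T.QperpH => T.G f).prod := by
    induction l with
    | nil => simp
    | cons f l ih =>
      rw [List.map_cons, List.prod_cons, map_mul, ih, par_G, List.length_cons, pow_succ']
      rw [← mul_assoc, ← mul_assoc, neg_mul, ← (Commute.neg_one_left (T.G f)).pow_left l.length]
      simp [mul_assoc]
  rw [h, hl.neg_one_pow, neg_one_mul]

/-- The basic sign rule. A product of k generators from Q^⊥H moves past `B` at the cost of k
applications of `par`, and `par` is an involution. -/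
theorem odd_mul {A : T.Gar} (hA : A ∈ T.odd) (B : T.Gar) : A * B = T.par B * A := by
  refine T.odd_induction (p := fun A => A * B = T.par B * A)
    (isClosed_eq (continuous_id.mul continuous_const) (continuous_const.mul continuous_id))
    (by simp)
    (fun A C hA hC => by rw [add_mul, hA, hC, mul_add]) (fun c A hA => by
      rw [smul_mul_assoc, hA, mul_smul_comm]) (fun l hl => ?_) hA
  have h (l : List T.QperpH) : (l.map fun f : T.QperpH => T.G f).prod * B =
      T.par^[l.length] B * (l.map fun f : T.QperpH => T.G f).prod := by
    induction l with
    | nil => simp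
    | cons f l ih =>
      rw [List.map_cons, List.prod_cons, mul_assoc, ih, ← mul_assoc, G_perp_mul,
        List.length_cons, Function.iterate_succ_apply', mul_assoc]
  rw [h]
  obtain ⟨k, hk⟩ := hl
  rw [hk, Function.iterate_add_apply, Function.iterate_one, Function.iterate_mul,
    show (⇑T.par)^[2] = id from funext fun A => T.par_par A, Function.iterate_id, id]

theorem odd_mul_odd {A B : T.Gar} (hA : A ∈ T.odd) (hB : B ∈ T.odd) : A * B = -(B * A) := by
  rw [T.odd_mul hA, T.par_odd hB, neg_mul]

theorem odd_mul_self {A : T.Gar} (hA : A ∈ T.odd) : A * A = 0 := by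
  have h := eq_neg_iff_add_eq_zero.1 (T.odd_mul_odd hA hA)
  rw [← two_smul ℂ] at h
  exact (smul_eq_zero_iff_right two_ne_zero).1 h

theorem par_mem_grass {A : T.Gar} (hA : A ∈ T.grass) : T.par A ∈ T.grass := by
  refine T.grass_induction (p := fun A => T.par A ∈ T.grass) (T.isClosed_grass.preimage
    T.continuous_par) (fun c => ?_) (fun f => ?_) (fun A B hA hB => ?_) (fun A B hA hB => ?_) hA
  · rw [AlgHom.commutes]; exact Subalgebra.algebraMap_mem _ c
  · rw [par_G]; exact neg_mem (T.G_mem_grass f)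
  · rw [map_add]; exact add_mem hA hB
  · rw [map_mul]; exact mul_mem hA hB

/-- Unlike `G_perp_mul`, this allows any `f`, at the price of restricting `A` to Λ: the generators
of Λ anticommute even with the G(f) that do not square to zero. -/
theorem G_mul_grass (f : H) {A : T.Gar} (hA : A ∈ T.grass) : T.G f * A = T.par A * T.G f := by
  have hp := T.continuous_par
  refine T.grass_induction (p := fun A => T.G f * A = T.par A * T.G f)
    (isClosed_eq (continuous_const.mul continuous_id) (hp.mul continuous_const)) ?_ ?_ ?_ ?_ hA
  · intro c; rw [AlgHom.commutes]; exact (Algebra.commutes c _).symm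
  · intro h; rw [par_G, neg_mul, T.G_anticomm_perp h f, neg_neg]
  · intro A B hA hB; rw [mul_add, hA, hB, map_add, add_mul]
  · intro A B hA hB; rw [← mul_assoc, hA, mul_assoc, hB, map_mul, mul_assoc]

/-! ### Separation of coefficients by Grassmann generators -/

/-- An element of the algebraic GAR algebra involves only finitely many modes. -/
theorem exists_finite_modes {A : T.Gar} (hA : A ∈ Algebra.adjoin ℂ (Set.range T.G)) :
    ∃ F : Finset H, ∀ x : CAR.Op T.HQ,
      (∀ f ∈ F, x * T.garVal (T.G f) = -(T.garVal (T.G f) * x)) →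
        x * T.garVal A = T.garVal (T.par A) * x := by
  classical
  induction hA using Algebra.adjoin_induction with
  | mem y hy =>
    obtain ⟨f, rfl⟩ := hy
    refine ⟨{f}, fun x hx => ?_⟩
    rw [hx f (by simp), par_G, map_neg, neg_mul]
  | algebraMap c =>
    refine ⟨∅, fun x _ => ?_⟩
    rw [AlgHom.commutes, AlgHom.commutes]; exact (Algebra.commutes c x).symm
  | add A B _ _ hA hB =>
    obtain ⟨F, hF⟩ := hA
    obtain ⟨F', hF'⟩ := hB
    refine ⟨F ∪ F', fun x hx => ?_⟩
    rw [map_add, mul_add, hF x fun f hf => hx f (by simp [hf]),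
      hF' x fun f hf => hx f (by simp [hf]), map_add, map_add, add_mul]
  | mul A B _ _ hA hB =>
    obtain ⟨F, hF⟩ := hA
    obtain ⟨F', hF'⟩ := hB
    refine ⟨F ∪ F', fun x hx => ?_⟩
    rw [map_mul, ← mul_assoc, hF x fun f hf => hx f (by simp [hf]), mul_assoc,
      hF' x fun f hf => hx f (by simp [hf]), map_mul, map_mul, mul_assoc]

/-- Finitely many functionals have a common nonzero kernel vector on an infinite-dimensional space.
All later appeals to the infinite rank of Q^⊥ go back to this one. -/
theorem exists_unit_orthogonal (hT : ¬ FiniteDimensional ℂ T.QperpH) (F : Finset H) :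
    ∃ h : T.QperpH, ‖(h : H)‖ = 1 ∧ ∀ f ∈ F, ⟪(h : H), f⟫_ℂ = 0 := by
  let L : T.QperpH →ₗ[ℂ] F → ℂ := LinearMap.pi fun f => (innerₛₗ ℂ (f : H)) ∘ₗ T.QperpH.subtype
  have hL : ¬ Function.Injective L := fun h => hT (FiniteDimensional.of_injective L h)
  rw [← LinearMap.ker_eq_bot, Submodule.eq_bot_iff] at hL
  push Not at hL
  obtain ⟨h, hh, h0⟩ := hL
  have hn : ‖h‖ ≠ 0 := norm_ne_zero_iff.2 h0
  refine ⟨(‖h‖⁻¹ : ℂ) • h, ?_, fun f hf => ?_⟩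
  · have : ‖(h : H)‖ ≠ 0 := hn
    simp [norm_smul, this]
  · have h1 : ⟪f, (h : H)⟫_ℂ = 0 := congrFun (LinearMap.mem_ker.1 hh) ⟨f, hf⟩
    rw [Submodule.coe_smul, inner_smul_left, ← inner_conj_symm, h1]
    simp

theorem eq_of_anticommute {R : Type*} [Ring R] {a b c d : R} (hcar : b * a + a * b = 1)
    (h : c * b = b * d) : c = b * (d * a) + c * a * b :=
  calc c = c * (b * a + a * b) := by rw [hcar, mul_one]
    _ = c * b * a + c * a * b := by rw [mul_add, mul_assoc, mul_assoc]
    _ = _ := by rw [h, mul_assoc]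

-- Take `b` = G(h)* with h a unit vector orthogonal to all modes of `c`. Then b G(h) + G(h) b = 1,
-- while c b = b `par` c; inserting the first relation in c = c · 1 gives the decomposition. It
-- bounds `c` by its products with G(h).
set_option maxHeartbeats 1000000 in
theorem exists_mode (hT : ¬ FiniteDimensional ℂ T.QperpH) {c : T.Gar}
    (hc : c ∈ Algebra.adjoin ℂ (Set.range T.G)) :
    ∃ (h : T.QperpH) (b : CAR.Op T.HQ), ‖T.G h‖ ≤ 1 ∧ ‖b‖ ≤ 1 ∧
      T.garVal c = b * T.garVal (T.par c * T.G h) + T.garVal (c * T.G h) * b := by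
  obtain ⟨F, hF⟩ := T.exists_finite_modes hc
  obtain ⟨h, hh1, hhF⟩ := T.exists_unit_orthogonal hT F
  obtain ⟨a, ha⟩ : ∃ a, a = T.garVal (T.G h) := ⟨_, rfl⟩
  have hstar : star a = CAR.field T.JQ (T.JQ (WithLp.toLp 2 ((h : H), 0))) := by
    rw [ha, garVal_G, CAR.field_adjoint _ T.JQ_JQ]
  obtain ⟨b, hb⟩ : ∃ b, b = star a := ⟨_, rfl⟩
  have hcar : b * a + a * b = 1 := by
    rw [hb, hstar, ha, garVal_G, CAR.field_anticomm _ T.inner_JQ_left, T.JQ_JQ]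
    simp [WithLp.prod_inner_apply, hh1]
  have h1 : b * T.garVal c = T.garVal (T.par c) * b := by
    refine hF _ fun f hf => ?_
    rw [eq_neg_iff_add_eq_zero, hb, hstar, garVal_G, CAR.field_anticomm _ T.inner_JQ_left, T.JQ_JQ]
    simp [WithLp.prod_inner_apply, hhF f hf]
  -- The finite-mode rule has `b` on the left of `c`. Applying the grading, under which `b` is odd,
  -- gives the opposite order.
  have hgb : CAR.grading T.HQ b = -b := by rw [hb, hstar, CAR.grading_field]
  have h2 : T.garVal c * b = b * T.garVal (T.par c) := by
    have h2 := congrArg (CAR.grading T.HQ) h1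
    rw [map_mul, map_mul, hgb, ← garVal_par, ← garVal_par, par_par, neg_mul, mul_neg,
      neg_inj] at h2
    exact h2.symm
  refine ⟨h, b, ?_, ?_, ?_⟩
  · rw [← norm_garVal, ← ha]
    exact CAR.norm_le_one_of_car (by rw [← hb, hcar])
  · refine CAR.norm_le_one_of_car (a := b) ?_
    have hs : star b = a := by rw [hb]; exact star_star a
    rw [hs]
    exact (add_comm _ _).trans hcar
  · rw [map_mul, map_mul, ← ha]
    exact eq_of_anticommute hcar h2

/-- An element that is annihilated by all generators of the Grassmann part vanishes. -/
theorem eq_zero_of_mul_G (hT : ¬ FiniteDimensional ℂ T.QperpH) {c : T.Gar}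
    (hc : ∀ h : T.QperpH, c * T.G h = 0) : c = 0 := by
  rw [← norm_le_zero_iff]
  refine le_of_forall_pos_le_add fun δ hδ => ?_
  -- The mode decomposition needs an algebraic element. For c' near c, c' G(h) = (c' - c) G(h) is
  -- small, hence so is c'; the three thirds are the two terms of the decomposition and the
  -- approximation error.
  obtain ⟨c', hc', hd⟩ := Metric.mem_closure_iff.1 (T.dense_adjoin_G c) (δ / 3) (by positivity)
  rw [dist_eq_norm, norm_sub_rev] at hd
  obtain ⟨h, b, hh, hb, hdec⟩ := T.exists_mode hT hc'
  have e1 : ‖c' * T.G h‖ ≤ δ / 3 := by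
    have : c' * T.G h = (c' - c) * T.G h := by rw [sub_mul, hc, sub_zero]
    rw [this]
    calc _ ≤ ‖c' - c‖ * ‖T.G h‖ := norm_mul_le _ _
      _ ≤ δ / 3 * 1 := by gcongr
      _ = δ / 3 := mul_one _
  have e2 : ‖T.par c' * T.G h‖ ≤ δ / 3 := by
    have : T.par c' * T.G h = -T.par (c' * T.G h) := by
      rw [map_mul, par_G, mul_neg, neg_neg]
    rw [this, norm_neg]
    exact (T.norm_par_le _).trans e1
  have e3 : ‖c'‖ ≤ δ / 3 + δ / 3 := by
    rw [← norm_garVal, hdec]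
    refine (norm_add_le _ _).trans (add_le_add ?_ ?_)
    · refine (norm_mul_le _ _).trans ?_
      rw [norm_garVal, ← one_mul (δ / 3)]
      exact mul_le_mul hb e2 (norm_nonneg _) zero_le_one
    · refine (norm_mul_le _ _).trans ?_
      rw [norm_garVal, ← mul_one (δ / 3)]
      exact mul_le_mul e1 hb (norm_nonneg _) (by positivity)
  have e4 : ‖c‖ ≤ ‖c'‖ + ‖c' - c‖ := by
    have := norm_sub_le c' (c' - c)
    rwa [sub_sub_cancel] at this
  linarith

/-- If all products `c G(h₁) ⋯ G(hₖ)` vanish, then `c` vanishes. -/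
theorem eq_zero_of_mul_prod_G (hT : ¬ FiniteDimensional ℂ T.QperpH) {ι : Type*} (l : List ι)
    (hl : l.Nodup) (c : T.Gar)
    (hc : ∀ h : ι → T.QperpH, c * (l.map fun i => T.G (h i)).prod = 0) : c = 0 := by
  classical
  induction l generalizing c with
  | nil => simpa using hc fun _ => 0
  | cons i l ih =>
    rw [List.nodup_cons] at hl
    refine T.eq_zero_of_mul_G hT fun k => ih hl.2 _ fun h => ?_
    -- As `i` does not occur in `l`, its generator can be chosen freely without disturbing the
    -- remaining factors.
    have h1 := hc (Function.update h i k)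
    rw [List.map_cons, List.prod_cons, Function.update_self, ← mul_assoc] at h1
    rw [← h1]
    congr 2
    refine List.map_congr_left fun j hj => ?_
    rw [Function.update_of_ne (by rintro rfl; exact hl.1 hj)]

theorem comp_mem_odd (u : H) (ξ : T.Phase) : T.comp u ξ ∈ T.odd := by
  induction ξ using TensorProduct.induction_on with
  | zero => rw [map_zero]; exact zero_mem _
  | tmul f l => rw [comp_tmul]; exact T.odd.smul_mem _ l.2
  | add x y hx hy => rw [map_add]; exact add_mem hx hy

/-! ### Algebras of polynomials in odd variables -/

section Polynomials

/-- The algebra of functions that is generated by constants in `M` and by the functions `θ i`. -/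
noncomputable def polyAlg {V ι : Type*} (M : Subalgebra ℂ T.Gar) (θ : ι → V → T.Gar) :
    Subalgebra ℂ (V → T.Gar) :=
  Algebra.adjoin ℂ ({F | ∃ X ∈ M, F = fun _ => X} ∪ Set.range θ)

variable {T} {V W ι κ : Type*} {M : Subalgebra ℂ T.Gar} {θ : ι → V → T.Gar} {θ' : κ → W → T.Gar}

theorem const_mem_polyAlg {X : T.Gar} (hX : X ∈ M) : (fun _ => X) ∈ T.polyAlg M θ :=
  Algebra.subset_adjoin (Or.inl ⟨X, hX, rfl⟩)

theorem var_mem_polyAlg (i : ι) : θ i ∈ T.polyAlg M θ :=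
  Algebra.subset_adjoin (Or.inr ⟨i, rfl⟩)

theorem polyAlg_mono {M' : Subalgebra ℂ T.Gar} (h : M ≤ M') : T.polyAlg M θ ≤ T.polyAlg M' θ := by
  refine Algebra.adjoin_mono (Set.union_subset_union_left _ ?_)
  rintro _ ⟨X, hX, rfl⟩
  exact ⟨X, h hX, rfl⟩

/-- Substitution: a change of variables need only be checked on the generators. Affine maps, slices
and the swap of two variables are all instances. -/
theorem comp_mem_polyAlg {F : V → T.Gar} (hF : F ∈ T.polyAlg M θ) (p : W → V)
    (hp : ∀ i, (fun w => θ i (p w)) ∈ T.polyAlg M θ') :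
    (fun w => F (p w)) ∈ T.polyAlg M θ' := by
  induction hF using Algebra.adjoin_induction with
  | mem F hF =>
    rcases hF with ⟨X, hX, rfl⟩ | ⟨i, rfl⟩
    · exact const_mem_polyAlg hX
    · exact hp i
  | algebraMap c => exact Subalgebra.algebraMap_mem _ c
  | add F F' _ _ hF hF' => exact add_mem hF hF'
  | mul F F' _ _ hF hF' => exact mul_mem hF hF'

theorem prod_par (θ : ι → T.Gar) (hθ : ∀ i, θ i ∈ T.odd) (l : List ι) (A : T.Gar) :
    (l.map θ).prod * A = T.par^[l.length] A * (l.map θ).prod := by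
  induction l with
  | nil => simp
  | cons i l ih =>
    rw [List.map_cons, List.prod_cons, mul_assoc, ih, ← mul_assoc, T.odd_mul (hθ i),
      List.length_cons, Function.iterate_succ_apply', mul_assoc]

theorem iterate_par_mem (hM : ∀ X ∈ M, T.par X ∈ M) (k : ℕ) {X : T.Gar} (hX : X ∈ M) :
    T.par^[k] X ∈ M := by
  induction k with
  | zero => exact hX
  | succ k ih => rw [Function.iterate_succ_apply']; exact hM _ ih

/-- The elements of the polynomial algebra are sums of monomials `X θ_{i₁} ⋯ θ_{iₖ}`. -/
theorem polyAlg_induction (hM : ∀ X ∈ M, T.par X ∈ M) (hθ : ∀ i v, θ i v ∈ T.odd)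
    {p : (V → T.Gar) → Prop}
    (hmono : ∀ X ∈ M, ∀ l : List ι, p fun v => X * (l.map fun i => θ i v).prod)
    (hadd : ∀ F F', F ∈ T.polyAlg M θ → F' ∈ T.polyAlg M θ → p F → p F' → p (F + F'))
    {F : V → T.Gar} (hF : F ∈ T.polyAlg M θ) : p F := by
  have hmem (X : T.Gar) (hX : X ∈ M) (l : List ι) :
      (fun v => X * (l.map fun i => θ i v).prod) ∈ T.polyAlg M θ := by
    refine mul_mem (const_mem_polyAlg hX) ?_
    induction l with
    | nil => exact one_mem _
    | cons i l ih =>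
      simp only [List.map_cons, List.prod_cons]
      exact mul_mem (var_mem_polyAlg i) ih
  have h1 : F ∈ AddSubmonoid.closure
      {F | ∃ X ∈ M, ∃ l : List ι, F = fun v => X * (l.map fun i => θ i v).prod} := by
    induction hF using Algebra.adjoin_induction with
    | mem F hF =>
      rcases hF with ⟨X, hX, rfl⟩ | ⟨i, rfl⟩
      · exact AddSubmonoid.subset_closure ⟨X, hX, [], by simp⟩
      · exact AddSubmonoid.subset_closure ⟨1, one_mem _, [i], by simp⟩
    | algebraMap c =>
      exact AddSubmonoid.subset_closure ⟨_, Subalgebra.algebraMap_mem M c, [], by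
        ext v; simp [Pi.algebraMap_apply]⟩
    | add F F' _ _ hF hF' => exact add_mem hF hF'
    | mul F F' h h' hF hF' =>
      clear h h'
      induction hF, hF' using AddSubmonoid.closure_induction₂ with
      | mem F F' hF hF' =>
        obtain ⟨X, hX, l, rfl⟩ := hF
        obtain ⟨Y, hY, m, rfl⟩ := hF'
        -- The coefficient `Y` is moved left past the variables of the first monomial; stability of
        -- `M` under parity keeps the new coefficient in `M`.
        refine AddSubmonoid.subset_closure ⟨X * T.par^[l.length] Y,
          mul_mem hX (iterate_par_mem hM _ hY), l ++ m, ?_⟩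
        ext v
        rw [Pi.mul_apply, List.map_append, List.prod_append, mul_assoc X, ← mul_assoc _ Y,
          prod_par _ (fun i => hθ i v), mul_assoc, mul_assoc]
      | zero_left F hF => rw [zero_mul]; exact zero_mem _
      | zero_right F hF => rw [mul_zero]; exact zero_mem _
      | add_left F F' F'' _ _ _ h h' => rw [add_mul]; exact add_mem h h'
      | add_right F F' F'' _ _ _ h h' => rw [mul_add]; exact add_mem h h'
  have h2 : F ∈ T.polyAlg M θ ∧ p F := by
    clear hF
    induction h1 using AddSubmonoid.closure_induction with
    | mem F hF => obtain ⟨X, hX, l, rfl⟩ := hF; exact ⟨hmem X hX l, hmono X hX l⟩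
    | zero => exact ⟨zero_mem _, by simpa [Pi.zero_def] using hmono 0 (zero_mem _) []⟩
    | add F F' _ _ hF hF' => exact ⟨add_mem hF.1 hF'.1, hadd _ _ hF.1 hF'.1 hF.2 hF'.2⟩
  exact h2.2

end Polynomials

/-! ### Coordinates on the phase space -/

section Coordinates

variable {T} {n : ℕ} (e : OrthonormalBasis (Fin (2 * n)) ℂ T.QH)

/-- The coordinate functions `ξ ↦ ξ_i`. -/
noncomputable def coord (i : Fin (2 * n)) (ξ : T.Phase) : T.Gar := T.comp (e i) ξ

theorem coord_mem_odd (i : Fin (2 * n)) (ξ : T.Phase) : coord e i ξ ∈ T.odd := T.comp_mem_odd _ _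

theorem coord_add (i : Fin (2 * n)) (ξ η : T.Phase) :
    coord e i (ξ + η) = coord e i ξ + coord e i η := map_add _ _ _

theorem coord_smul (i : Fin (2 * n)) (c : ℂ) (ξ : T.Phase) :
    coord e i (c • ξ) = c • coord e i ξ := map_smul _ _ _

theorem coord_neg (i : Fin (2 * n)) (ξ : T.Phase) :
    coord e i (-ξ) = -coord e i ξ := map_neg _ _

theorem coord_sub (i : Fin (2 * n)) (ξ η : T.Phase) :
    coord e i (ξ - η) = coord e i ξ - coord e i η := map_sub _ _ _

theorem coord_mul_coord (i j : Fin (2 * n)) (ξ η : T.Phase) :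
    coord e i ξ * coord e j η = -(coord e j η * coord e i ξ) :=
  T.odd_mul_odd (coord_mem_odd e i ξ) (coord_mem_odd e j η)

theorem comp_eq_sum (u : T.QH) (ξ : T.Phase) :
    T.comp u ξ = ∑ i, ⟪(u : H), e i⟫_ℂ • coord e i ξ := by
  unfold coord
  induction ξ using TensorProduct.induction_on with
  | zero => simp
  | tmul f l =>
    simp only [comp_tmul, smul_smul, ← Finset.sum_smul]
    congr 1
    exact (e.sum_inner_mul_inner u f).symm
  | add x y hx hy => simp only [map_add, hx, hy, smul_add, Finset.sum_add_distrib]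

theorem bose_eq_sum (ξ : T.Phase) : T.bose ξ = ∑ i, T.G (e i) * coord e i ξ := by
  unfold coord
  induction ξ using TensorProduct.induction_on with
  | zero => simp
  | tmul f l =>
    simp only [comp_tmul, mul_smul_comm]
    have h : (f : H) = ∑ i, ⟪(e i : H), (f : H)⟫_ℂ • (e i : H) := by
      conv_lhs => rw [← e.sum_repr' f]
      simp
    change T.G f * (l : T.Gar) = _
    conv_lhs => rw [h]
    simp only [map_sum, map_smul, Finset.sum_mul, smul_mul_assoc]
  | add x y hx hy => simp only [map_add, hx, hy, mul_add, Finset.sum_add_distrib]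

/-- Parseval's identity, together with ⟪J f, eᵢ⟫ = ⟪J eᵢ, f⟫ = ⟪eᵢ, f⟫; this is where the reality of
the basis enters. -/
theorem symp_eq_sum (he : ∀ i, T.J (e i) = e i) (ξ η : T.Phase) :
    T.symp ξ η = -∑ i, coord e i ξ * coord e i η := by
  unfold coord
  induction ξ using TensorProduct.induction_on with
  | zero => simp
  | add x y hx hy =>
    simp only [map_add, LinearMap.add_apply, hx, hy, add_mul, Finset.sum_add_distrib, neg_add]
  | tmul f l =>
    induction η using TensorProduct.induction_on with
    | zero => simp
    | add x y hx hy => simp only [map_add, hx, hy, mul_add, Finset.sum_add_distrib, neg_add]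
    | tmul h m =>
      simp only [symp_tmul, comp_tmul, smul_mul_smul_comm, ← Finset.sum_smul]
      congr 2
      have hJ : T.J f ∈ T.QH := by
        obtain ⟨f', hf'⟩ := f.2
        exact ⟨T.J f', by rw [← hf']; exact T.Q_J f'⟩
      refine (e.sum_inner_mul_inner ⟨T.J f, hJ⟩ h).symm.trans (Finset.sum_congr rfl fun i _ => ?_)
      congr 1
      change ⟪T.J f, (e i : H)⟫_ℂ = _
      rw [T.inner_J_left, he]

end Coordinates

/-! ### Polynomial representations and the Grassmann integral -/

section Representation

variable {T} {n : ℕ} (e : OrthonormalBasis (Fin (2 * n)) ℂ T.QH) (v : ⋀[ℂ]^(2 * n) T.QH)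

/-- The algebra of polynomial functions on the phase space with coefficients in `M`. -/
noncomputable abbrev pol (M : Subalgebra ℂ T.Gar) : Subalgebra ℂ (T.Phase → T.Gar) :=
  T.polyAlg M (coord e)

/-- Trades the span of monomials in arbitrary components for an algebra on the 2n coordinates, which
is visibly closed under products and substitutions. -/
theorem hol_eq_pol (F : T.Phase → T.Gar) : F ∈ T.hol ↔ F ∈ pol e T.grass := by
  constructor
  · intro hF
    induction hF using Submodule.span_induction with
    | zero => exact zero_mem _
    | add F F' _ _ hF hF' => exact add_mem hF hF'
    | smul c F _ hF => exact Subalgebra.smul_mem _ hF c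
    | mem F hF =>
      obtain ⟨X, hX, l, rfl⟩ := hF
      refine mul_mem (const_mem_polyAlg hX) ?_
      simp only [← coe_list_map (fun u : H => T.comp u _)]
      induction l with
      | nil => exact one_mem _
      | cons u l ih =>
        simp only [List.map_cons, List.prod_cons]
        refine mul_mem ?_ ih
        have h : ⇑(T.comp (u : H)) = ∑ i, ⟪(u : H), e i⟫_ℂ • coord e i := by
          ext ξ
          rw [comp_eq_sum e]
          simp
        rw [h]
        exact sum_mem fun i _ => Subalgebra.smul_mem _ (var_mem_polyAlg i) _
  · intro hF
    refine polyAlg_induction (p := fun F => F ∈ T.hol) (fun X => T.par_mem_grass)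
      (fun i v => coord_mem_odd e i v) (fun X hX l => ?_) (fun F F' _ _ => add_mem) hF
    refine Submodule.subset_span ⟨X, hX, l.map e, ?_⟩
    funext ξ
    rw [← coe_list_map (fun u : H => T.comp u ξ), List.map_map]
    rfl

/-- Sorting a word of odd variables costs a sign independent of the point, and a repeated variable
makes the word vanish. The scalar 0 is recorded in the latter case because the support of the word
may still be the full index set. -/
theorem exists_sign_monomial (l : List (Fin (2 * n))) :
    ∃ s : ℂ, (¬ l.Nodup → s = 0) ∧
      ∀ ξ, (l.map fun i => coord e i ξ).prod = s • monomial e l.toFinset ξ := by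
  have hperm (l l' : List (Fin (2 * n))) (h : l.Perm l') :
      ∃ s : ℂ, ∀ ξ, (l.map fun i => coord e i ξ).prod = s • (l'.map fun i => coord e i ξ).prod := by
    induction h with
    | nil => exact ⟨1, fun ξ => by simp⟩
    | cons i _ ih =>
      obtain ⟨s, hs⟩ := ih
      exact ⟨s, fun ξ => by simp only [List.map_cons, List.prod_cons, hs, mul_smul_comm]⟩
    | swap i j l =>
      refine ⟨-1, fun ξ => ?_⟩
      simp only [List.map_cons, List.prod_cons, ← mul_assoc]
      rw [coord_mul_coord]; simp
    | trans _ _ ih ih' =>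
      obtain ⟨s, hs⟩ := ih
      obtain ⟨s', hs'⟩ := ih'
      exact ⟨s * s', fun ξ => by rw [hs, hs', smul_smul]⟩
  by_cases hl : l.Nodup
  · obtain ⟨s, hs⟩ := hperm l (l.toFinset.sort (· ≤ ·)) (by
      rw [List.perm_ext_iff_of_nodup hl (Finset.sort_nodup _ _)]; simp)
    exact ⟨s, fun h => absurd hl h, hs⟩
  · refine ⟨0, fun _ => rfl, fun ξ => ?_⟩
    rw [zero_smul]
    obtain ⟨i, hi⟩ : ∃ i, List.Duplicate i l := by
      simpa [List.nodup_iff_forall_not_duplicate] using hl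
    have hi := List.duplicate_iff_two_le_count.1 hi
    have h1 : i ∈ l := List.count_pos_iff.1 (by omega)
    have h2 : i ∈ l.erase i := List.count_pos_iff.1 (by rw [List.count_erase_self]; omega)
    -- Two copies of the repeated letter are brought to the front, where their product is a square
    -- of an odd element.
    have hl' := (List.perm_cons_erase h1).trans ((List.perm_cons_erase h2).cons i)
    obtain ⟨s, hs⟩ := hperm l _ hl'
    rw [hs]
    simp only [List.cons_append, List.nil_append, List.map_cons, List.prod_cons, ← mul_assoc]
    rw [T.odd_mul_self (coord_mem_odd e i ξ)]
    simp

theorem exists_rep {F : T.Phase → T.Gar} (hF : F ∈ pol e ⊤) : ∃ c, IsPolyRep e F c := by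
  refine polyAlg_induction (p := fun F => ∃ c, IsPolyRep e F c) (fun _ _ => Algebra.mem_top)
    (coord_mem_odd e) ?_ ?_ hF
  · intro X _ l
    obtain ⟨s, -, hs⟩ := exists_sign_monomial e l
    refine ⟨fun I => if I = l.toFinset then s • X else 0, fun ξ => ?_⟩
    simp [hs, ite_mul]
  · rintro F F' _ _ ⟨c, hc⟩ ⟨c', hc'⟩
    exact ⟨fun I => c I + c' I, fun ξ => by
      simp only [Pi.add_apply, hc ξ, hc' ξ, add_mul, Finset.sum_add_distrib]⟩

/-- The coefficients of a polynomial representation of the zero function vanish. -/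
theorem IsPolyRep.eq_zero (hT : ¬ FiniteDimensional ℂ T.QperpH)
    {c : Finset (Fin (2 * n)) → T.Gar} (hc : IsPolyRep e (fun _ => 0) c)
    (I : Finset (Fin (2 * n))) : c I = 0 := by
  induction I using Finset.strongInduction with
  | H I ih =>
    refine T.eq_zero_of_mul_prod_G hT (I.sort (· ≤ ·)) (Finset.sort_nodup _ _) _ fun h => ?_
    -- A test point with coordinates G(h_j) for j in `I` and 0 elsewhere. Monomials not supported in
    -- `I` vanish there, those on proper subsets have zero coefficient by induction, and only c I ∏
    -- G(h_j) is left, with arbitrary h_j.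
    let ξ : T.Phase := ∑ j ∈ I, (e j) ⊗ₜ (⟨T.G (h j), T.G_mem_odd (h j)⟩ : T.odd)
    have hξ (i : Fin (2 * n)) : T.comp (e i) ξ = if i ∈ I then T.G (h i) else 0 := by
      have hi (j : Fin (2 * n)) : ⟪(e i : H), (e j : H)⟫_ℂ = if i = j then 1 else 0 :=
        orthonormal_iff_ite.1 e.orthonormal i j
      simp [ξ, hi]
    have h1 : (0 : T.Gar) = ∑ J, c J * monomial e J ξ := hc ξ
    rw [Finset.sum_eq_single I] at h1
    · rw [h1]
      congr 2
      refine List.map_congr_left fun j hj => ?_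
      rw [hξ, if_pos ((Finset.mem_sort _).1 hj)]
    · intro J _ hJ
      by_cases hs : J ⊆ I
      · rw [ih J (lt_of_le_of_ne hs hJ), zero_mul]
      · obtain ⟨i, hi, hi'⟩ := Finset.not_subset.1 hs
        rw [monomial, List.prod_eq_zero, mul_zero]
        exact List.mem_map.2 ⟨i, (Finset.mem_sort _).2 hi, by rw [hξ, if_neg hi']⟩
    · simp

/-- Uniqueness of coefficients makes the integral independent of the representation chosen in its
definition. -/
theorem integral_eq (hT : ¬ FiniteDimensional ℂ T.QperpH) {F : T.Phase → T.Gar}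
    {c : Finset (Fin (2 * n)) → T.Gar} (hc : IsPolyRep e F c) :
    integral e v F = topCoord e v • c Finset.univ := by
  have h : ∃ c, IsPolyRep e F c := ⟨c, hc⟩
  rw [integral, dif_pos h]
  have h0 : IsPolyRep e (fun _ => 0) fun I => h.choose I - c I := fun ξ => by
    simp only [sub_mul, Finset.sum_sub_distrib]
    rw [← h.choose_spec ξ, ← hc ξ, sub_self]
  rw [sub_eq_zero.1 (h0.eq_zero e hT Finset.univ)]

theorem integral_add (hT : ¬ FiniteDimensional ℂ T.QperpH) {F F' : T.Phase → T.Gar}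
    (hF : F ∈ pol e ⊤) (hF' : F' ∈ pol e ⊤) :
    integral e v (F + F') = integral e v F + integral e v F' := by
  obtain ⟨c, hc⟩ := exists_rep e hF
  obtain ⟨c', hc'⟩ := exists_rep e hF'
  have h : IsPolyRep e (F + F') fun I => c I + c' I := fun ξ => by
    simp only [Pi.add_apply, hc ξ, hc' ξ, add_mul, Finset.sum_add_distrib]
  rw [integral_eq e v hT hc, integral_eq e v hT hc', integral_eq e v hT h, smul_add]

/-- The integral of a monomial. -/
theorem exists_integral_prod (hT : ¬ FiniteDimensional ℂ T.QperpH) (l : List (Fin (2 * n))) :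
    ∃ k : ℂ, (l.length ≠ 2 * n → k = 0) ∧
      ∀ X, integral e v (fun η => X * (l.map fun i => coord e i η).prod) = k • X := by
  obtain ⟨s, hs0, hs⟩ := exists_sign_monomial e l
  refine ⟨if l.toFinset = Finset.univ then topCoord e v * s else 0, fun h => ?_, fun X => ?_⟩
  · split_ifs with h1
    · by_cases hl : l.Nodup
      · exfalso
        rw [← List.toFinset_card_of_nodup hl, h1] at h
        simp at h
      · rw [hs0 hl, mul_zero]
    · rfl
  · have h : IsPolyRep e (fun η => X * (l.map fun i => coord e i η).prod)
        fun I => if I = l.toFinset then s • X else 0 := fun ξ => by simp [hs, ite_mul]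
    rw [integral_eq e v hT h]
    split_ifs with h1 h2 h2
    · rw [smul_smul]
    · exact absurd h1.symm h2
    · exact absurd h2.symm h1
    · simp

end Representation

/-! ### Module properties, invariance and Fubini's theorem for the integral -/

section Integration

variable {T} {n : ℕ} (e : OrthonormalBasis (Fin (2 * n)) ℂ T.QH) (v : ⋀[ℂ]^(2 * n) T.QH)
  {M : Subalgebra ℂ T.Gar}

theorem const_mul_prod_mem_pol {X : T.Gar} (hX : X ∈ M) (l : List (Fin (2 * n))) :
    (fun η => X * (l.map fun i => coord e i η).prod) ∈ pol e M := by
  refine mul_mem (const_mem_polyAlg hX) ?_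
  induction l with
  | nil => exact one_mem _
  | cons i l ih =>
    simp only [List.map_cons, List.prod_cons]
    exact mul_mem (var_mem_polyAlg i) ih

theorem mul_left_mem_pol {X : T.Gar} (hX : X ∈ M) {F : T.Phase → T.Gar} (hF : F ∈ pol e M) :
    (fun η => X * F η) ∈ pol e M := mul_mem (const_mem_polyAlg hX) hF

theorem mul_right_mem_pol {X : T.Gar} (hX : X ∈ M) {F : T.Phase → T.Gar} (hF : F ∈ pol e M) :
    (fun η => F η * X) ∈ pol e M := mul_mem hF (const_mem_polyAlg hX)

theorem pol_le_top {F : T.Phase → T.Gar} (hF : F ∈ pol e M) : F ∈ pol e ⊤ :=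
  polyAlg_mono le_top hF

theorem iterate_par_even (A : T.Gar) : T.par^[2 * n] A = A := by
  rw [Function.iterate_mul, show (⇑T.par)^[2] = id from funext fun A => T.par_par A,
    Function.iterate_id, id]

theorem integral_mul_left (hT : ¬ FiniteDimensional ℂ T.QperpH) (X : T.Gar) {F : T.Phase → T.Gar}
    (hF : F ∈ pol e ⊤) : integral e v (fun η => X * F η) = X * integral e v F := by
  refine polyAlg_induction
    (p := fun F => integral e v (fun η => X * F η) = X * integral e v F)
    (fun _ _ => Algebra.mem_top) (coord_mem_odd e) ?_ ?_ hF
  · intro Y _ l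
    obtain ⟨k, -, hk⟩ := exists_integral_prod e v hT l
    simp only [← mul_assoc, hk, mul_smul_comm]
  · intro F F' hF hF' h h'
    rw [integral_add e v hT hF hF', mul_add, ← h, ← h',
      ← integral_add e v hT (mul_left_mem_pol e Algebra.mem_top hF)
        (mul_left_mem_pol e Algebra.mem_top hF')]
    congr 1
    ext η
    simp only [Pi.add_apply, mul_add]

/-- Only words of length 2n contribute, and moving `X` past an even number of odd variables leaves
it unchanged. -/
theorem integral_mul_right (hT : ¬ FiniteDimensional ℂ T.QperpH) (X : T.Gar)
    {F : T.Phase → T.Gar} (hF : F ∈ pol e ⊤) :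
    integral e v (fun η => F η * X) = integral e v F * X := by
  refine polyAlg_induction
    (p := fun F => integral e v (fun η => F η * X) = integral e v F * X)
    (fun _ _ => Algebra.mem_top) (coord_mem_odd e) ?_ ?_ hF
  · intro Y _ l
    obtain ⟨k, hk0, hk⟩ := exists_integral_prod e v hT l
    have h1 (η : T.Phase) : Y * (l.map fun i => coord e i η).prod * X =
        Y * T.par^[l.length] X * (l.map fun i => coord e i η).prod := by
      rw [mul_assoc, prod_par _ (fun i => coord_mem_odd e i η), mul_assoc]
    simp only [h1, hk, smul_mul_assoc]
    by_cases hl : l.length = 2 * n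
    · rw [hl, iterate_par_even]
    · rw [hk0 hl, zero_smul, zero_smul]
  · intro F F' hF hF' h h'
    rw [integral_add e v hT hF hF', add_mul, ← h, ← h',
      ← integral_add e v hT (mul_right_mem_pol e Algebra.mem_top hF)
        (mul_right_mem_pol e Algebra.mem_top hF')]
    exact congrArg (integral e v) (funext fun η => add_mul _ _ _)

theorem prod_coord_mem_grass (l : List (Fin (2 * n))) (ξ : T.Phase) :
    (l.map fun i => coord e i ξ).prod ∈ T.grass := by
  refine list_prod_mem ?_
  simp only [List.mem_map]
  rintro _ ⟨i, _, rfl⟩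
  exact T.odd_le_grass (coord_mem_odd e i ξ)

theorem pol_grass_apply_mem {F : T.Phase → T.Gar} (hF : F ∈ pol e T.grass) (ξ : T.Phase) :
    F ξ ∈ T.grass := by
  refine polyAlg_induction (p := fun F => F ξ ∈ T.grass) (fun _ => T.par_mem_grass)
    (coord_mem_odd e) ?_ ?_ hF
  · intro X hX l; exact mul_mem hX (prod_coord_mem_grass e l ξ)
  · intro F F' _ _; exact add_mem

/-- A right module map from the GAR algebra into `M` maps polynomials to polynomials with
coefficients in `M`. -/
theorem map_mem_pol (φ : T.Gar →ₗ[ℂ] T.Gar) (hφ : ∀ A, ∀ l ∈ T.grass, φ (A * l) = φ A * l)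
    (hM : ∀ A, φ A ∈ M) {F : T.Phase → T.Gar} (hF : F ∈ pol e ⊤) :
    (fun η => φ (F η)) ∈ pol e M := by
  refine polyAlg_induction (p := fun F => (fun η => φ (F η)) ∈ pol e M)
    (fun _ _ => Algebra.mem_top) (coord_mem_odd e) ?_ ?_ hF
  · intro X _ l
    simp only [hφ _ _ (prod_coord_mem_grass e l _)]
    exact const_mul_prod_mem_pol e (hM X) l
  · intro F F' _ _ h h'
    simp only [Pi.add_apply, map_add]
    exact add_mem h h'

/-- The coordinates lie in Λ, so a right Λ-linear map acts on the coefficients alone. -/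
theorem integral_map (hT : ¬ FiniteDimensional ℂ T.QperpH) (φ : T.Gar →ₗ[ℂ] T.Gar)
    (hφ : ∀ A, ∀ l ∈ T.grass, φ (A * l) = φ A * l) {F : T.Phase → T.Gar} (hF : F ∈ pol e ⊤) :
    integral e v (fun η => φ (F η)) = φ (integral e v F) := by
  refine polyAlg_induction
    (p := fun F => integral e v (fun η => φ (F η)) = φ (integral e v F))
    (fun _ _ => Algebra.mem_top) (coord_mem_odd e) ?_ ?_ hF
  · intro X _ l
    obtain ⟨k, -, hk⟩ := exists_integral_prod e v hT l
    simp only [hφ _ _ (prod_coord_mem_grass e l _), hk, map_smul]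
  · intro F F' hF hF' h h'
    rw [integral_add e v hT hF hF', map_add, ← h, ← h', ← integral_add e v hT
      (map_mem_pol e φ hφ (fun _ => Algebra.mem_top) hF)
      (map_mem_pol e φ hφ (fun _ => Algebra.mem_top) hF')]
    congr 1
    ext η
    simp only [Pi.add_apply, map_add]

section Affine

/-- The polynomials of degree less than `d`. -/
noncomputable def lowDegree (d : ℕ) : Submodule ℂ (T.Phase → T.Gar) :=
  Submodule.span ℂ {F | ∃ (X : T.Gar) (l : List (Fin (2 * n))), l.length < d ∧
    F = fun η => X * (l.map fun i => coord e i η).prod}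

theorem lowDegree_le_pol {d : ℕ} {F : T.Phase → T.Gar} (hF : F ∈ lowDegree e d) :
    F ∈ pol e ⊤ := by
  refine (Submodule.span_le (p := Subalgebra.toSubmodule (pol e ⊤))).2 ?_ hF
  rintro _ ⟨X, l, -, rfl⟩
  exact const_mul_prod_mem_pol e Algebra.mem_top l

theorem lowDegree_mono {d d' : ℕ} (h : d ≤ d') : lowDegree e d ≤ lowDegree e d' := by
  refine Submodule.span_mono ?_
  rintro _ ⟨X, l, hl, rfl⟩
  exact ⟨X, l, hl.trans_le h, rfl⟩

theorem const_mul_mem_lowDegree {d : ℕ} {F : T.Phase → T.Gar} (hF : F ∈ lowDegree e d)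
    (X : T.Gar) : (fun η => X * F η) ∈ lowDegree e d := by
  induction hF using Submodule.span_induction with
  | mem F hF =>
    obtain ⟨Y, l, hl, rfl⟩ := hF
    exact Submodule.subset_span ⟨X * Y, l, hl, by simp only [mul_assoc]⟩
  | zero => simp only [Pi.zero_apply, mul_zero]; exact zero_mem (lowDegree e d)
  | add F F' _ _ h h' => simp only [Pi.add_apply, mul_add]; exact add_mem h h'
  | smul c F _ h => simp only [Pi.smul_apply, mul_smul_comm]; exact Submodule.smul_mem _ c h

theorem coord_mul_mem_lowDegree {d : ℕ} {F : T.Phase → T.Gar} (hF : F ∈ lowDegree e d)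
    (i : Fin (2 * n)) : (fun η => coord e i η * F η) ∈ lowDegree e (d + 1) := by
  induction hF using Submodule.span_induction with
  | mem F hF =>
    obtain ⟨Y, l, hl, rfl⟩ := hF
    refine Submodule.subset_span ⟨T.par Y, i :: l, by simpa using hl, ?_⟩
    ext η
    rw [← mul_assoc, T.odd_mul (coord_mem_odd e i η), mul_assoc, List.map_cons, List.prod_cons]
  | zero => simp only [Pi.zero_apply, mul_zero]; exact zero_mem (lowDegree e (d + 1))
  | add F F' _ _ h h' => simp only [Pi.add_apply, mul_add]; exact add_mem h h'
  | smul c F _ h => simp only [Pi.smul_apply, mul_smul_comm]; exact Submodule.smul_mem _ c h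

theorem integral_smul (hT : ¬ FiniteDimensional ℂ T.QperpH) (c : ℂ) {F : T.Phase → T.Gar}
    (hF : F ∈ pol e ⊤) : integral e v (c • F) = c • integral e v F := by
  have h := integral_mul_left e v hT (algebraMap ℂ _ c) hF
  simp only [← Algebra.smul_def] at h
  exact h

theorem integral_lowDegree (hT : ¬ FiniteDimensional ℂ T.QperpH) {d : ℕ} (hd : d ≤ 2 * n)
    {F : T.Phase → T.Gar} (hF : F ∈ lowDegree e d) : integral e v F = 0 := by
  have h0 : integral e v (0 : T.Phase → T.Gar) = 0 := by
    simpa using integral_smul e v hT 0 (zero_mem (pol e ⊤))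
  induction hF using Submodule.span_induction with
  | mem F hF =>
    obtain ⟨Y, l, hl, rfl⟩ := hF
    obtain ⟨k, hk0, hk⟩ := exists_integral_prod e v hT l
    rw [hk, hk0 (by omega), zero_smul]
  | zero => exact h0
  | add F F' hF hF' h h' =>
    rw [integral_add e v hT (lowDegree_le_pol e hF) (lowDegree_le_pol e hF'), h, h', add_zero]
  | smul c F hF h => rw [integral_smul e v hT c (lowDegree_le_pol e hF), h, smul_zero]

/-- Expanding the product, every term other than the leading one has lost a variable. The constants
`b i` may be arbitrary elements of the GAR algebra, not only odd Grassmann ones. -/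
theorem prod_affine_sub_mem_lowDegree (t : ℂ) (b : Fin (2 * n) → T.Gar)
    (l : List (Fin (2 * n))) :
    (fun η => (l.map fun i => t • coord e i η + b i).prod -
      t ^ l.length • (l.map fun i => coord e i η).prod) ∈ lowDegree e l.length := by
  induction l with
  | nil => simp only [List.map_nil, List.prod_nil, List.length_nil, pow_zero, one_smul, sub_self]
           exact zero_mem (lowDegree e 0)
  | cons i l ih =>
    have h1 := Submodule.smul_mem _ t (coord_mul_mem_lowDegree e ih i)
    have h2 := lowDegree_mono e (Nat.le_succ _) (const_mul_mem_lowDegree e ih (b i))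
    have h3 : (fun η => (t ^ l.length • b i) * (l.map fun i => coord e i η).prod) ∈
        lowDegree e (l.length + 1) := Submodule.subset_span ⟨_, l, Nat.lt_succ_self _, rfl⟩
    refine (congrArg (· ∈ lowDegree e (l.length + 1)) (funext fun η => ?_)).mpr
      (add_mem (add_mem h1 h2) h3)
    simp only [List.map_cons, List.prod_cons, List.length_cons, Pi.add_apply, Pi.smul_apply,
      mul_sub, add_mul, smul_sub, mul_smul_comm, smul_mul_assoc, smul_smul, pow_succ']
    abel

/-- Used twice: with `b i` = ζ_i for invariance of the integral, and with `b i` = G(e_i), `t` = -1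
for averages over translations. Beyond length 2n the lower-order terms could contribute, hence the
bound. -/
theorem integral_prod_affine (hT : ¬ FiniteDimensional ℂ T.QperpH) (t : ℂ)
    (b : Fin (2 * n) → T.Gar) (X : T.Gar) {l : List (Fin (2 * n))} (hl : l.length ≤ 2 * n) :
    integral e v (fun η => X * (l.map fun i => t • coord e i η + b i).prod) =
      t ^ l.length • integral e v (fun η => X * (l.map fun i => coord e i η).prod) := by
  have h1 := const_mul_mem_lowDegree e (prod_affine_sub_mem_lowDegree e t b l) X
  have h2 : (fun η => X * (l.map fun i => t • coord e i η + b i).prod) =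
      (fun η => X * ((l.map fun i => t • coord e i η + b i).prod -
        t ^ l.length • (l.map fun i => coord e i η).prod)) +
      t ^ l.length • fun η => X * (l.map fun i => coord e i η).prod := by
    ext η
    simp only [Pi.add_apply, Pi.smul_apply, mul_sub, mul_smul_comm, sub_add_cancel]
  have h3 : (fun η => X * (l.map fun i => coord e i η).prod) ∈ pol e ⊤ :=
    const_mul_prod_mem_pol e Algebra.mem_top l
  rw [h2, integral_add e v hT (lowDegree_le_pol e h1) (Subalgebra.smul_mem _ h3 _),
    integral_lowDegree e v hT hl h1, zero_add, integral_smul e v hT _ h3]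

theorem affine_mem_pol {F : T.Phase → T.Gar} (hF : F ∈ pol e ⊤) (t : ℂ) (ζ : T.Phase) :
    (fun η => F (t • η + ζ)) ∈ pol e ⊤ := by
  refine comp_mem_polyAlg hF (fun η => t • η + ζ) fun i => ?_
  simp only [coord_add, coord_smul]
  exact add_mem (Subalgebra.smul_mem _ (var_mem_polyAlg i) t) (const_mem_polyAlg Algebra.mem_top)

/-- Invariance of the Grassmann integral under translations and reflections. -/
theorem integral_affine (hT : ¬ FiniteDimensional ℂ T.QperpH) {t : ℂ} (ht : t ^ 2 = 1)
    (ζ : T.Phase) {F : T.Phase → T.Gar} (hF : F ∈ pol e ⊤) :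
    integral e v (fun η => F (t • η + ζ)) = integral e v F := by
  refine polyAlg_induction
    (p := fun F => integral e v (fun η => F (t • η + ζ)) = integral e v F)
    (fun _ _ => Algebra.mem_top) (coord_mem_odd e) ?_ ?_ hF
  · intro X _ l
    by_cases hl : l.length ≤ 2 * n
    · simp only [coord_add, coord_smul]
      rw [integral_prod_affine e v hT t (fun i => coord e i ζ) X hl]
      by_cases hl' : l.length = 2 * n
      · rw [hl', pow_mul, ht, one_pow, one_smul]
      · obtain ⟨k, hk0, hk⟩ := exists_integral_prod e v hT l
        rw [hk, hk0 hl', zero_smul, smul_zero]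
    -- A word longer than 2n repeats a variable and vanishes at every point, so no expansion is
    -- needed.
    · obtain ⟨s, hs0, hs⟩ := exists_sign_monomial e l
      have h0 : s = 0 := hs0 fun h => hl (by simpa using h.length_le_card)
      simp only [hs, h0, zero_smul]
  · intro F F' hF hF' h h'
    rw [integral_add e v hT hF hF', ← h, ← h',
      ← integral_add e v hT (affine_mem_pol e hF t ζ) (affine_mem_pol e hF' t ζ)]
    rfl

end Affine

section Fubini

/-- The coordinate functions of a pair of phase space points. -/
noncomputable def coord₂ : Fin (2 * n) ⊕ Fin (2 * n) → T.Phase × T.Phase → T.Gar :=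
  Sum.elim (fun i p => coord e i p.1) (fun i p => coord e i p.2)

/-- The algebra of polynomial functions of two phase space variables. -/
noncomputable abbrev pol₂ (M : Subalgebra ℂ T.Gar) : Subalgebra ℂ (T.Phase × T.Phase → T.Gar) :=
  T.polyAlg M (coord₂ e)

theorem coord₂_mem_odd (i : Fin (2 * n) ⊕ Fin (2 * n)) (p : T.Phase × T.Phase) :
    coord₂ e i p ∈ T.odd := by
  rcases i with i | i <;> exact coord_mem_odd e _ _

theorem fst_mem_pol₂ {F : T.Phase → T.Gar} (hF : F ∈ pol e M) :
    (fun p : T.Phase × T.Phase => F p.1) ∈ pol₂ e M :=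
  comp_mem_polyAlg hF _ fun i => var_mem_polyAlg (θ := coord₂ e) (Sum.inl i)

theorem snd_mem_pol₂ {F : T.Phase → T.Gar} (hF : F ∈ pol e M) :
    (fun p : T.Phase × T.Phase => F p.2) ∈ pol₂ e M :=
  comp_mem_polyAlg hF _ fun i => var_mem_polyAlg (θ := coord₂ e) (Sum.inr i)

theorem comp_mem_pol₂ {F : T.Phase → T.Gar} (hF : F ∈ pol e M) (p : T.Phase × T.Phase → T.Phase)
    (hp : ∀ i, (fun q => coord e i (p q)) ∈ pol₂ e M) : (fun q => F (p q)) ∈ pol₂ e M :=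
  comp_mem_polyAlg hF p hp

theorem swap_mem_pol₂ {K : T.Phase × T.Phase → T.Gar} (hK : K ∈ pol₂ e M) :
    (fun p => K p.swap) ∈ pol₂ e M := by
  refine comp_mem_polyAlg hK _ fun i => ?_
  rcases i with i | i
  · exact var_mem_polyAlg (θ := coord₂ e) (Sum.inr i)
  · exact var_mem_polyAlg (θ := coord₂ e) (Sum.inl i)

theorem slice_mem_pol {K : T.Phase × T.Phase → T.Gar} (hK : K ∈ pol₂ e M) (ξ : T.Phase) :
    (fun η => K (ξ, η)) ∈ pol e ⊤ := by
  refine comp_mem_polyAlg (T := T) (θ' := coord e) (polyAlg_mono le_top hK) (fun η => (ξ, η))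
    fun i => ?_
  rcases i with i | i
  · exact const_mem_polyAlg (X := coord e i ξ) Algebra.mem_top
  · exact var_mem_polyAlg (θ := coord e) i

/-- Coordinates of the two points anticommute, so up to sign every word can be sorted with the first
point's coordinates on the left. -/
theorem pol₂_induction (hM : ∀ X ∈ M, T.par X ∈ M) {p : (T.Phase × T.Phase → T.Gar) → Prop}
    (hmono : ∀ X ∈ M, ∀ l m : List (Fin (2 * n)),
      p fun q => X * (l.map fun i => coord e i q.1).prod * (m.map fun i => coord e i q.2).prod)
    (hadd : ∀ F F', F ∈ pol₂ e M → F' ∈ pol₂ e M → p F → p F' → p (F + F'))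
    {F : T.Phase × T.Phase → T.Gar} (hF : F ∈ pol₂ e M) : p F := by
  refine polyAlg_induction hM (coord₂_mem_odd e) (fun X hX l => ?_) hadd hF
  have h : ∃ (l₁ l₂ : List (Fin (2 * n))) (s : ℂ), ∀ q : T.Phase × T.Phase,
      (l.map fun i => coord₂ e i q).prod =
        s • ((l₁.map fun i => coord e i q.1).prod * (l₂.map fun i => coord e i q.2).prod) := by
    induction l with
    | nil => exact ⟨[], [], 1, fun q => by simp⟩
    | cons i l ih =>
      obtain ⟨l₁, l₂, s, hs⟩ := ih
      rcases i with i | i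
      · refine ⟨i :: l₁, l₂, s, fun q => ?_⟩
        rw [List.map_cons, List.prod_cons, hs, List.map_cons, List.prod_cons, mul_smul_comm,
          ← mul_assoc]
        rfl
      · refine ⟨l₁, i :: l₂, s * (-1) ^ l₁.length, fun q => ?_⟩
        have hpar (k : ℕ) (ξ : T.Phase) :
            T.par^[k] (coord e i ξ) = (-1 : ℂ) ^ k • coord e i ξ := by
          induction k with
          | zero => simp
          | succ k ih =>
            rw [Function.iterate_succ_apply', ih, map_smul, T.par_odd (coord_mem_odd e i ξ),
              pow_succ, mul_smul, neg_one_smul]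
        have h1 := prod_par _ (fun i => coord_mem_odd e i q.1) l₁ (coord e i q.2)
        rw [hpar] at h1
        have h2 : coord e i q.2 * (l₁.map fun i => coord e i q.1).prod =
            (-1 : ℂ) ^ l₁.length • ((l₁.map fun i => coord e i q.1).prod * coord e i q.2) := by
          rw [h1, smul_mul_assoc, smul_smul, ← mul_pow]; simp
        rw [List.map_cons, List.prod_cons, hs, List.map_cons, List.prod_cons, mul_smul_comm,
          ← mul_assoc, show coord₂ e (Sum.inr i) q = coord e i q.2 from rfl, h2, smul_mul_assoc,
          smul_smul, mul_assoc]
  obtain ⟨l₁, l₂, s, hs⟩ := h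
  have := hmono (s • X) (Subalgebra.smul_mem _ hX s) l₁ l₂
  simpa only [hs, mul_smul_comm, smul_mul_assoc, mul_assoc] using this

/-- Integrating out one variable leaves a polynomial in the other with coefficients in the same `M`;
this puts f * f' and F f into the algebra of Λ-valued functions. -/
theorem integral_slice_mem_pol (hT : ¬ FiniteDimensional ℂ T.QperpH)
    (hM : ∀ X ∈ M, T.par X ∈ M) {K : T.Phase × T.Phase → T.Gar} (hK : K ∈ pol₂ e M) :
    (fun ξ => integral e v fun η => K (ξ, η)) ∈ pol e M := by
  refine pol₂_induction (p := fun K => (fun ξ => integral e v fun η => K (ξ, η)) ∈ pol e M) e hM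
    ?_ ?_ hK
  · intro X hX l m
    obtain ⟨k, -, hk⟩ := exists_integral_prod e v hT m
    simp only [hk]
    exact Subalgebra.smul_mem _ (const_mul_prod_mem_pol e hX l) k
  · intro K K' hK hK' h h'
    convert add_mem h h' using 1
    ext ξ
    exact integral_add e v hT (slice_mem_pol e hK ξ) (slice_mem_pol e hK' ξ)

/-- Fubini's theorem for the Grassmann integral. -/
theorem integral_comm (hT : ¬ FiniteDimensional ℂ T.QperpH) {K : T.Phase × T.Phase → T.Gar}
    (hK : K ∈ pol₂ e ⊤) :
    integral e v (fun ξ => integral e v fun η => K (ξ, η)) =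
      integral e v (fun η => integral e v fun ξ => K (ξ, η)) := by
  have htop : ∀ X ∈ (⊤ : Subalgebra ℂ T.Gar), T.par X ∈ (⊤ : Subalgebra ℂ T.Gar) :=
    fun _ _ => Algebra.mem_top
  refine pol₂_induction (p := fun K => integral e v (fun ξ => integral e v fun η => K (ξ, η)) =
    integral e v (fun η => integral e v fun ξ => K (ξ, η))) e htop ?_ ?_ hK
  · intro X hX l m
    obtain ⟨k, -, hk⟩ := exists_integral_prod e v hT m
    obtain ⟨k', -, hk'⟩ := exists_integral_prod e v hT l
    -- For the inner integral over the first variable, the word in the second stands on the right as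
    -- a constant; it leaves the integral without a sign because 2n is even.
    have h (η : T.Phase) : integral e v (fun ξ => X * (l.map fun i => coord e i ξ).prod *
        (m.map fun i => coord e i η).prod) = (k' • X) * (m.map fun i => coord e i η).prod := by
      rw [integral_mul_right e v hT _ (const_mul_prod_mem_pol e Algebra.mem_top l), hk']
    simp only [h, hk, ← smul_mul_assoc, hk']
    rw [smul_comm]
  · intro K K' hK hK' h h'
    have e1 := integral_add e v hT (integral_slice_mem_pol e v hT htop hK)
      (integral_slice_mem_pol e v hT htop hK')
    have e2 := integral_add e v hT (integral_slice_mem_pol e v hT htop (swap_mem_pol₂ e hK))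
      (integral_slice_mem_pol e v hT htop (swap_mem_pol₂ e hK'))
    simp only [Prod.swap_prod_mk] at e2
    rw [h, h', ← e2] at e1
    convert e1 using 2
    · ext ξ
      exact integral_add e v hT (slice_mem_pol e hK ξ) (slice_mem_pol e hK' ξ)
    · ext η
      exact integral_add e v hT (slice_mem_pol e (swap_mem_pol₂ e hK) η)
        (slice_mem_pol e (swap_mem_pol₂ e hK') η)

end Fubini

end Integration

/-! ### Exponentials of nilpotent sums -/

section Exponential

variable {T}

theorem exp_of_mul_self_eq_zero {x : T.Gar} (hx : x * x = 0) : NormedSpace.exp x = 1 + x := by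
  rw [NormedSpace.exp_eq_tsum ℂ]
  change ∑' k : ℕ, ((k.factorial : ℂ)⁻¹) • x ^ k = 1 + x
  rw [tsum_eq_sum (s := Finset.range 2)]
  · simp [Finset.sum_range_succ]
  · intro k hk
    obtain ⟨m, rfl⟩ := Nat.exists_eq_add_of_le' (not_lt.1 fun h => hk (Finset.mem_range.2 h))
    rw [pow_add, pow_two, hx, mul_zero, smul_zero]

/-- With commuting summands of square zero the exponential is the finite product of the factors 1 +
xᵢ. This makes both the Weyl operators and the Fourier kernel polynomial. -/
theorem exp_sum_mem {V ι : Type*} (A : Subalgebra ℂ (V → T.Gar)) (s : Finset ι)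
    (x : ι → V → T.Gar) (hx : ∀ i, x i ∈ A) (hc : ∀ i j v, Commute (x i v) (x j v))
    (h0 : ∀ i v, x i v * x i v = 0) : (fun v => NormedSpace.exp (∑ i ∈ s, x i v)) ∈ A := by
  classical
  induction s using Finset.induction_on with
  | empty => simp only [Finset.sum_empty, NormedSpace.exp_zero]; exact one_mem A
  | insert a s ha ih =>
    have h (v : V) : NormedSpace.exp (∑ i ∈ insert a s, x i v) =
        (1 + x a v) * NormedSpace.exp (∑ i ∈ s, x i v) := by
      rw [Finset.sum_insert ha, NormedSpace.exp_add_of_commute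
        (Commute.sum_right _ _ _ fun i _ => hc a i v), exp_of_mul_self_eq_zero (h0 a v)]
    simp only [h]
    exact mul_mem (add_mem (one_mem A) (hx a)) ih

end Exponential

/-! ### Weyl operators and phase space translations -/

section Weyl

variable {T} {n : ℕ} (e : OrthonormalBasis (Fin (2 * n)) ℂ T.QH)

theorem G_mul_coord (f : H) (j : Fin (2 * n)) (ξ : T.Phase) :
    T.G f * coord e j ξ = -(coord e j ξ * T.G f) := by
  rw [T.odd_mul (coord_mem_odd e j ξ), par_G, neg_mul, neg_neg]

theorem G_anticomm_basis (he : ∀ i, T.J (e i) = e i) (i j : Fin (2 * n)) :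
    T.G (e i) * T.G (e j) + T.G (e j) * T.G (e i) = if i = j then 1 else 0 := by
  have hQ : T.Q (e j : H) = e j := by
    obtain ⟨f, hf⟩ := (e j).2
    rw [← hf]; exact T.Q_Q f
  have hi : ⟪(e i : H), (e j : H)⟫_ℂ = if i = j then 1 else 0 :=
    orthonormal_iff_ite.1 e.orthonormal i j
  rw [G_anticomm, he, hQ, hi]
  split_ifs <;> simp

theorem mode_mul_mode (i j : Fin (2 * n)) (ξ : T.Phase) :
    T.G (e i) * coord e i ξ * (T.G (e j) * coord e j ξ) =
      -(T.G (e i) * T.G (e j) * (coord e i ξ * coord e j ξ)) := by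
  have h := G_mul_coord e (e j) i ξ
  rw [eq_neg_iff_add_eq_zero, add_comm, ← eq_neg_iff_add_eq_zero] at h
  rw [mul_assoc, ← mul_assoc (coord e i ξ), h]
  simp only [neg_mul, mul_neg, mul_assoc]

/-- For distinct modes both the G's and the coordinates anticommute, and the two signs cancel. -/
theorem mode_commute (he : ∀ i, T.J (e i) = e i) (i j : Fin (2 * n)) (ξ : T.Phase) :
    Commute (T.G (e i) * coord e i ξ) (T.G (e j) * coord e j ξ) := by
  by_cases hij : i = j
  · rw [hij]
  · have h := G_anticomm_basis e he i j
    rw [if_neg hij, ← eq_neg_iff_add_eq_zero] at h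
    rw [Commute, SemiconjBy, mode_mul_mode, mode_mul_mode, h, coord_mul_coord e i j]
    simp

theorem mode_mul_self (i : Fin (2 * n)) (ξ : T.Phase) :
    T.G (e i) * coord e i ξ * (T.G (e i) * coord e i ξ) = 0 := by
  rw [mode_mul_mode, T.odd_mul_self (coord_mem_odd e i ξ), mul_zero, neg_zero]

theorem mode_commute_grass (i : Fin (2 * n)) (ξ : T.Phase) {A : T.Gar} (hA : A ∈ T.grass) :
    Commute (T.G (e i) * coord e i ξ) A := by
  rw [Commute, SemiconjBy, mul_assoc, T.odd_mul (coord_mem_odd e i ξ), ← mul_assoc,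
    T.G_mul_grass _ (T.par_mem_grass hA), par_par, mul_assoc]

theorem coord_mul_coord_commute (i : Fin (2 * n)) (ξ η : T.Phase) (A : T.Gar) :
    Commute (coord e i ξ * coord e i η) A := by
  rw [Commute, SemiconjBy, mul_assoc, T.odd_mul (coord_mem_odd e i η), ← mul_assoc,
    T.odd_mul (coord_mem_odd e i ξ), par_par, mul_assoc]

include e in
theorem weyl_commute_grass (ξ : T.Phase) {A : T.Gar} (hA : A ∈ T.grass) :
    Commute (T.weyl ξ) A := by
  refine Commute.exp_left ?_
  rw [bose_eq_sum e]
  exact Commute.sum_left _ _ _ fun i _ => mode_commute_grass e i ξ hA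

theorem weyl_mul_weyl_neg (ξ : T.Phase) : T.weyl ξ * T.weyl (-ξ) = 1 := by
  rw [weyl, weyl, map_neg, ← NormedSpace.exp_add_of_commute (Commute.neg_right (Commute.refl _)),
    add_neg_cancel, NormedSpace.exp_zero]

theorem weyl_neg_mul_weyl (ξ : T.Phase) : T.weyl (-ξ) * T.weyl ξ = 1 := by
  simpa using weyl_mul_weyl_neg (-ξ)

variable (T) in
/-- The phase space translations as algebra homomorphisms. -/
noncomputable def translateHom (ξ : T.Phase) : T.Gar →ₐ[ℂ] T.Gar where
  toFun := T.translate ξ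
  map_one' := by rw [translate, mul_one, weyl_neg_mul_weyl]
  map_mul' A B := by
    simp only [translate]
    rw [show T.weyl (-ξ) * A * T.weyl ξ * (T.weyl (-ξ) * B * T.weyl ξ) =
      T.weyl (-ξ) * A * (T.weyl ξ * T.weyl (-ξ)) * B * T.weyl ξ by simp only [mul_assoc],
      weyl_mul_weyl_neg]
    simp only [mul_assoc, one_mul]
  map_zero' := by simp [translate]
  map_add' A B := by simp only [translate, mul_add, add_mul]
  commutes' c := by
    rw [translate, Algebra.algebraMap_eq_smul_one, mul_smul_comm, smul_mul_assoc, mul_one,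
      weyl_neg_mul_weyl]

theorem translateHom_apply (ξ : T.Phase) (A : T.Gar) :
    T.translateHom ξ A = T.translate ξ A := rfl

theorem continuous_translateHom (ξ : T.Phase) : Continuous (T.translateHom ξ) :=
  (continuous_const.mul continuous_id).mul continuous_const

include e in
theorem translate_grass (ξ : T.Phase) {A : T.Gar} (hA : A ∈ T.grass) : T.translate ξ A = A := by
  rw [translate, mul_assoc, ← (weyl_commute_grass e ξ hA).eq, ← mul_assoc, weyl_neg_mul_weyl,
    one_mul]

/-- All modes of w(ζ) but the i-th commute with G(e_i), so only the factor 1 + G(e_i) ζ_i matters.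
The shift by ζ_i comes from 2 G(e_i)² = 1. -/
theorem translate_G_basis (he : ∀ i, T.J (e i) = e i) (ζ : T.Phase) (i : Fin (2 * n)) :
    T.translate ζ (T.G (e i)) = T.G (e i) + coord e i ζ := by
  have hw : ∃ Y : T.Gar, Commute (T.G (e i)) Y ∧
      T.weyl ζ = NormedSpace.exp Y * (1 + T.G (e i) * coord e i ζ) := by
    refine ⟨∑ j ∈ Finset.univ.erase i, T.G (e j) * coord e j ζ, ?_, ?_⟩
    · refine Commute.sum_right _ _ _ fun j hj => ?_
      have h := G_anticomm_basis e he i j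
      rw [if_neg (Finset.ne_of_mem_erase hj).symm, ← eq_neg_iff_add_eq_zero] at h
      rw [Commute, SemiconjBy, ← mul_assoc, h, neg_mul, mul_assoc, G_mul_coord, mul_neg, neg_neg,
        mul_assoc]
    · rw [weyl, bose_eq_sum e, ← Finset.sum_erase_add _ _ (Finset.mem_univ i),
        NormedSpace.exp_add_of_commute
          (Commute.sum_left _ _ _ fun j _ => mode_commute e he j i ζ),
        exp_of_mul_self_eq_zero (mode_mul_self e i ζ)]
  obtain ⟨Y, hY, hw⟩ := hw
  have h2 := G_anticomm_basis e he i i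
  rw [if_pos rfl] at h2
  have h3 : T.G (e i) * (1 + T.G (e i) * coord e i ζ) =
      (1 + T.G (e i) * coord e i ζ) * (T.G (e i) + coord e i ζ) := by
    have h4 : T.G (e i) * coord e i ζ * T.G (e i) = -(T.G (e i) * T.G (e i) * coord e i ζ) := by
      rw [mul_assoc, mul_assoc, G_mul_coord, mul_neg, neg_neg]
    have h5 : coord e i ζ = T.G (e i) * T.G (e i) * coord e i ζ +
        T.G (e i) * T.G (e i) * coord e i ζ := by rw [← add_mul, h2, one_mul]
    rw [mul_add, mul_add, add_mul, add_mul, h4, mul_assoc _ (coord e i ζ) (coord e i ζ),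
      T.odd_mul_self (coord_mem_odd e i ζ), mul_zero, mul_one, one_mul, one_mul, ← mul_assoc]
    -- The third occurrence is the isolated ζ_i; the first two are already multiplied by G(e_i)².
    nth_rw 3 [h5]
    abel
  have h6 : T.G (e i) * T.weyl ζ = T.weyl ζ * (T.G (e i) + coord e i ζ) := by
    rw [hw, ← mul_assoc, (hY.exp_right).eq, mul_assoc, h3, mul_assoc]
  rw [translate, mul_assoc, h6, ← mul_assoc, weyl_neg_mul_weyl, one_mul]

theorem exists_G_eq (f : H) : ∃ (c : Fin (2 * n) → ℂ) (h : T.QperpH),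
    T.G f = ∑ i, c i • T.G (e i) + T.G h := by
  let q : T.QH := ⟨T.Q f, f, rfl⟩
  have h1 : (q : H) = ∑ i, ⟪e i, q⟫_ℂ • (e i : H) := by
    conv_lhs => rw [← e.sum_repr' q]
    simp
  refine ⟨fun i => ⟪e i, q⟫_ℂ, T.projPerp f, ?_⟩
  have h2 : f = ∑ i, ⟪e i, q⟫_ℂ • (e i : H) + T.projPerp f := by
    rw [← h1]; simp [q, projPerp]
  conv_lhs => rw [h2]
  simp only [map_add, map_sum, map_smul]

/-- Both sides are continuous homomorphisms, so it suffices to compare them on generators: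
coordinates add up, and Λ, which contains the shifts η_i, is fixed. -/
theorem translate_translate (he : ∀ i, T.J (e i) = e i) (ξ η : T.Phase) (A : T.Gar) :
    T.translate ξ (T.translate η A) = T.translate (ξ + η) A := by
  simp only [← translateHom_apply]
  refine T.gar_induction (p := fun A => T.translateHom ξ (T.translateHom η A) =
    T.translateHom (ξ + η) A) ?_ ?_ ?_ ?_ ?_ A
  · exact isClosed_eq ((continuous_translateHom ξ).comp (continuous_translateHom η))
      (continuous_translateHom _)
  · intro c; simp only [AlgHom.commutes]
  · intro f
    obtain ⟨c, h, hf⟩ := exists_G_eq e f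
    have hi (i : Fin (2 * n)) : T.translate ξ (coord e i η) = coord e i η :=
      translate_grass e ξ (T.odd_le_grass (coord_mem_odd e i η))
    rw [hf]
    simp only [map_add, map_sum, map_smul, translateHom_apply, translate_G_basis e he,
      translate_grass e _ (T.G_mem_grass h)]
    simp only [← translateHom_apply, map_add]
    simp only [translateHom_apply, translate_G_basis e he, hi, coord_add, add_assoc]
  · intro A B hA hB; simp only [map_add, hA, hB]
  · intro A B hA hB; simp only [map_mul, hA, hB]

theorem symp_commute (he : ∀ i, T.J (e i) = e i) (ξ η : T.Phase) (A : T.Gar) :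
    Commute (T.symp ξ η) A := by
  rw [symp_eq_sum e he]
  exact (Commute.sum_left _ _ _ fun i _ => coord_mul_coord_commute e i ξ η A).neg_left

theorem exp_symp_commute (he : ∀ i, T.J (e i) = e i) (ξ η : T.Phase) (A : T.Gar) :
    Commute (NormedSpace.exp (T.symp ξ η)) A := (symp_commute e he ξ η A).exp_left

theorem exp_symp_add (he : ∀ i, T.J (e i) = e i) (ξ η ζ : T.Phase) :
    NormedSpace.exp (T.symp ξ (η + ζ)) =
      NormedSpace.exp (T.symp ξ η) * NormedSpace.exp (T.symp ξ ζ) := by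
  rw [map_add, NormedSpace.exp_add_of_commute (symp_commute e he _ _ _)]

/-- α_ζ adds ∑ ζ_i ξ_i = -∑ ξ_i ζ_i = σ(ξ,ζ) to Φ(ξ). A continuous homomorphism commutes with the
exponential, and the central summand splits off. -/
theorem translate_weyl (he : ∀ i, T.J (e i) = e i) (ζ ξ : T.Phase) :
    T.translate ζ (T.weyl ξ) = T.weyl ξ * NormedSpace.exp (T.symp ξ ζ) := by
  have h : T.translateHom ζ (T.bose ξ) = T.bose ξ + T.symp ξ ζ := by
    rw [bose_eq_sum e, symp_eq_sum e he, map_sum, ← sub_eq_add_neg, ← Finset.sum_sub_distrib]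
    refine Finset.sum_congr rfl fun i _ => ?_
    rw [map_mul, translateHom_apply, translateHom_apply, translate_G_basis e he,
      translate_grass e ζ (T.odd_le_grass (coord_mem_odd e i ξ)), add_mul, coord_mul_coord e i i ζ,
      sub_eq_add_neg]
  rw [← translateHom_apply, weyl, NormedSpace.map_exp _ (continuous_translateHom ζ), h,
    NormedSpace.exp_add_of_commute (symp_commute e he ξ ζ _).symm]

theorem weyl_mem_pol (he : ∀ i, T.J (e i) = e i) : T.weyl ∈ pol e ⊤ := by
  have h (ξ : T.Phase) : T.weyl ξ = NormedSpace.exp (∑ i, T.G (e i) * coord e i ξ) := by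
    rw [weyl, bose_eq_sum e]
  rw [show T.weyl = fun ξ => NormedSpace.exp (∑ i, T.G (e i) * coord e i ξ) from funext h]
  exact exp_sum_mem _ _ (fun i ξ => T.G (e i) * coord e i ξ)
    (fun i => mul_left_mem_pol e Algebra.mem_top (var_mem_polyAlg i))
    (fun i j ξ => mode_commute e he i j ξ) (fun i ξ => mode_mul_self e i ξ)

theorem smul_mem_pol {M : Subalgebra ℂ T.Gar} {F : T.Phase → T.Gar} (hF : F ∈ pol e M) (t : ℂ) :
    (fun ξ => F (t • ξ)) ∈ pol e M := by
  refine comp_mem_polyAlg hF (fun ξ => t • ξ) fun i => ?_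
  simp only [coord_smul]
  exact Subalgebra.smul_mem _ (var_mem_polyAlg i) t

theorem neg_mem_pol {M : Subalgebra ℂ T.Gar} {F : T.Phase → T.Gar} (hF : F ∈ pol e M) :
    (fun ξ => F (-ξ)) ∈ pol e M := by
  refine comp_mem_polyAlg hF (fun ξ => -ξ) fun i => ?_
  simp only [coord_neg]
  exact neg_mem (var_mem_polyAlg i)

theorem translate_mem_pol (he : ∀ i, T.J (e i) = e i) (A : T.Gar) :
    (fun ξ => T.translate ξ A) ∈ pol e ⊤ :=
  mul_mem (mul_right_mem_pol e Algebra.mem_top (neg_mem_pol e (weyl_mem_pol e he)))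
    (weyl_mem_pol e he)

theorem exp_symp_mem_pol₂ (he : ∀ i, T.J (e i) = e i) :
    (fun p : T.Phase × T.Phase => NormedSpace.exp (T.symp p.1 p.2)) ∈ pol₂ e T.grass := by
  simp only [symp_eq_sum e he, ← Finset.sum_neg_distrib]
  refine exp_sum_mem _ _ (fun i (p : T.Phase × T.Phase) => -(coord e i p.1 * coord e i p.2))
    (fun i => ?_) (fun i j p => ?_) fun i p => ?_
  · exact neg_mem (mul_mem (fst_mem_pol₂ e (var_mem_polyAlg i))
      (snd_mem_pol₂ e (var_mem_polyAlg i)))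
  · exact (coord_mul_coord_commute e i _ _ _).neg_left
  · rw [neg_mul_neg, mul_assoc, ← (coord_mul_coord_commute e i p.1 p.2 (coord e i p.2)).eq,
      mul_assoc, T.odd_mul_self (coord_mem_odd e i p.2), mul_zero, mul_zero]

end Weyl

/-! ### Averages over all translations are Grassmann-valued -/

section Trace

variable {T} {n : ℕ} (e : OrthonormalBasis (Fin (2 * n)) ℂ T.QH) (v : ⋀[ℂ]^(2 * n) T.QH)

theorem prod_G_mul_grass (l : List (Fin (2 * n))) {A : T.Gar} (hA : A ∈ T.grass) :
    ∃ A' ∈ T.grass, (l.map fun i => T.G (e i)).prod * A = A' * (l.map fun i => T.G (e i)).prod := by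
  induction l with
  | nil => exact ⟨A, hA, by simp⟩
  | cons i l ih =>
    obtain ⟨A', hA', h⟩ := ih
    refine ⟨T.par A', T.par_mem_grass hA', ?_⟩
    rw [List.map_cons, List.prod_cons, mul_assoc, h, ← mul_assoc, T.G_mul_grass _ hA', mul_assoc]

theorem prod_G_mul_G (he : ∀ i, T.J (e i) = e i) (j : Fin (2 * n)) (l : List (Fin (2 * n)))
    (hj : j ∉ l) : ∃ s : ℂ, (l.map fun i => T.G (e i)).prod * T.G (e j) =
      s • (T.G (e j) * (l.map fun i => T.G (e i)).prod) := by
  induction l with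
  | nil => exact ⟨1, by simp⟩
  | cons i l ih =>
    rw [List.mem_cons, not_or] at hj
    obtain ⟨s, hs⟩ := ih hj.2
    have h := G_anticomm_basis e he i j
    rw [if_neg (Ne.symm hj.1), ← eq_neg_iff_add_eq_zero] at h
    refine ⟨-s, ?_⟩
    rw [List.map_cons, List.prod_cons, mul_assoc, hs, mul_smul_comm, ← mul_assoc, h, neg_mul,
      smul_neg, neg_smul, mul_assoc]

/-- The span of the normally ordered products `λ G(e_{i₁}) ⋯ G(e_{iₖ})` with pairwise different
indices and coefficients `λ` in the Grassmann part. -/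
noncomputable def normalSpan : Submodule ℂ T.Gar :=
  Submodule.span ℂ {A | ∃ X ∈ T.grass, ∃ l : List (Fin (2 * n)), l.Nodup ∧
    A = X * (l.map fun i => T.G (e i)).prod}

theorem mul_G_mem_normalSpan (he : ∀ i, T.J (e i) = e i) {A : T.Gar} (hA : A ∈ normalSpan e)
    (f : H) : A * T.G f ∈ normalSpan e := by
  induction hA using Submodule.span_induction with
  | zero => rw [zero_mul]; exact zero_mem _
  | add A B _ _ hA hB => rw [add_mul]; exact add_mem hA hB
  | smul c A _ hA => rw [smul_mul_assoc]; exact Submodule.smul_mem _ c hA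
  | mem A hA =>
    obtain ⟨X, hX, l, hl, rfl⟩ := hA
    obtain ⟨c, h, hf⟩ := exists_G_eq e f
    rw [hf, mul_add, Finset.mul_sum]
    refine add_mem (sum_mem fun j _ => ?_) ?_
    · rw [mul_smul_comm]
      refine Submodule.smul_mem _ _ ?_
      by_cases hj : j ∈ l
      -- If `j` already occurs, the new factor is moved left to its twin and the pair contracts to
      -- G(e_j)² = 1/2, so that the indices stay distinct.
      · obtain ⟨l₁, l₂, rfl⟩ := List.append_of_mem hj
        have hj2 : j ∉ l₂ := by
          rw [List.nodup_append] at hl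
          exact (List.nodup_cons.1 hl.2.1).1
        obtain ⟨s, hs⟩ := prod_G_mul_G e he j l₂ hj2
        have h2 : T.G (e j) * T.G (e j) = (2⁻¹ : ℂ) • (1 : T.Gar) := by
          have h2 := G_anticomm_basis e he j j
          rw [if_pos rfl, ← two_smul ℂ] at h2
          rw [← h2, smul_smul]; simp
        have h3 : X * ((l₁ ++ j :: l₂).map fun i => T.G (e i)).prod * T.G (e j) =
            (s * 2⁻¹) • (X * ((l₁ ++ l₂).map fun i => T.G (e i)).prod) := by
          simp only [List.map_append, List.prod_append, List.map_cons, List.prod_cons, mul_assoc]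
          rw [hs, mul_smul_comm, ← mul_assoc (T.G (e j)), h2]
          simp only [smul_mul_assoc, mul_smul_comm, one_mul, smul_smul]
        rw [h3]
        refine Submodule.smul_mem _ _ (Submodule.subset_span ⟨X, hX, l₁ ++ l₂, ?_, rfl⟩)
        exact hl.sublist (List.Sublist.append_left (List.sublist_cons_self j l₂) l₁)
      · refine Submodule.subset_span ⟨X, hX, l ++ [j], ?_, ?_⟩
        · rw [List.nodup_append]
          refine ⟨hl, List.nodup_singleton j, ?_⟩
          rintro a ha b hb rfl
          rw [List.mem_singleton] at hb
          exact hj (hb ▸ ha)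
        · simp [mul_assoc]
    · obtain ⟨X', hX', h'⟩ := prod_G_mul_grass e l (T.G_mem_grass h)
      exact Submodule.subset_span ⟨X * X', mul_mem hX hX', l, hl, by rw [mul_assoc, h', mul_assoc]⟩

theorem adjoin_le_normalSpan (he : ∀ i, T.J (e i) = e i) {A : T.Gar}
    (hA : A ∈ Algebra.adjoin ℂ (Set.range T.G)) : A ∈ normalSpan e := by
  have h : A ∈ Submodule.span ℂ (Submonoid.closure (Set.range T.G) : Set T.Gar) := by
    rw [← Algebra.adjoin_eq_span]; exact hA
  refine (Submodule.span_le (p := normalSpan e)).2 ?_ h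
  intro B hB
  induction hB using Submonoid.closure_induction_right with
  | one => exact Submodule.subset_span ⟨1, one_mem _, [], List.nodup_nil, by simp⟩
  | mul_right x _ y hy hx =>
    obtain ⟨f, rfl⟩ := hy
    exact mul_G_mem_normalSpan e he hx f

/-- The average `∫ α_{-η}(A)` of an operator over all translations. -/
noncomputable def average (he : ∀ i, T.J (e i) = e i) (hT : ¬ FiniteDimensional ℂ T.QperpH) :
    T.Gar →ₗ[ℂ] T.Gar where
  toFun A := integral e v fun η => T.translate (-η) A
  map_add' A B := by
    rw [← integral_add e v hT (neg_mem_pol e (translate_mem_pol e he A))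
      (neg_mem_pol e (translate_mem_pol e he B))]
    exact congrArg (integral e v) (funext fun η => map_add (T.translateHom (-η)) A B)
  map_smul' c A := by
    rw [RingHom.id_apply, ← integral_smul e v hT c (neg_mem_pol e (translate_mem_pol e he A))]
    exact congrArg (integral e v) (funext fun η => map_smul (T.translateHom (-η)) c A)

variable (he : ∀ i, T.J (e i) = e i) (hT : ¬ FiniteDimensional ℂ T.QperpH)

theorem average_apply (A : T.Gar) :
    average e v he hT A = integral e v fun η => T.translate (-η) A := rfl

theorem average_mul_grass (A l : T.Gar) (hl : l ∈ T.grass) :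
    average e v he hT (A * l) = average e v he hT A * l := by
  rw [average_apply, average_apply, ← integral_mul_right e v hT l
    (neg_mem_pol e (translate_mem_pol e he A))]
  refine congrArg (integral e v) (funext fun η => ?_)
  rw [← translateHom_apply, map_mul, translateHom_apply, translateHom_apply,
    translate_grass e _ hl]

/-- Translation replaces each G(e_i) by G(e_i) - η_i. Distinct indices bound the degree by 2n, so
the integral sees at most the product of the η_i, and every term that still contains some G(e_i)
drops out. -/
theorem average_normalSpan {A : T.Gar} (hA : A ∈ normalSpan e) :
    average e v he hT A ∈ T.grass := by
  induction hA using Submodule.span_induction with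
  | zero => rw [map_zero]; exact zero_mem _
  | add A B _ _ hA hB => rw [map_add]; exact add_mem hA hB
  | smul c A _ hA => rw [map_smul]; exact Subalgebra.smul_mem _ hA c
  | mem A hA =>
    obtain ⟨X, hX, l, hl, rfl⟩ := hA
    have h (η : T.Phase) : T.translate (-η) (X * (l.map fun i => T.G (e i)).prod) =
        X * (l.map fun i => (-1 : ℂ) • coord e i η + T.G (e i)).prod := by
      rw [← translateHom_apply, map_mul, map_list_prod, List.map_map, translateHom_apply,
        translate_grass e _ hX]
      congr 2
      refine List.map_congr_left fun i _ => ?_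
      rw [Function.comp_apply, translateHom_apply, translate_G_basis e he, coord_neg, neg_one_smul,
        add_comm]
    rw [average_apply]
    simp only [h]
    obtain ⟨k, -, hk⟩ := exists_integral_prod e v hT l
    rw [integral_prod_affine e v hT (-1) (fun i => T.G (e i)) X
      (by simpa using hl.length_le_card), hk]
    exact Subalgebra.smul_mem _ (Subalgebra.smul_mem _ hX _) _

/-- Polynomials on the phase space whose coefficients are bounded operators on the GAR algebra. -/
noncomputable def opPol : Submodule ℂ (T.Phase → T.Gar → T.Gar) :=
  Submodule.span ℂ {R | ∃ (S : T.Gar →L[ℂ] T.Gar) (l : List (Fin (2 * n))),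
    R = fun η B => S B * (l.map fun i => coord e i η).prod}

variable (T) in
/-- The parity automorphism as a bounded operator. -/
noncomputable def parL : T.Gar →L[ℂ] T.Gar := ⟨T.par.toLinearMap, T.continuous_par⟩

theorem parL_pow_apply (k : ℕ) (A : T.Gar) : (T.parL ^ k) A = T.par^[k] A := by
  induction k generalizing A with
  | zero => rfl
  | succ k ih => rw [pow_succ, Function.iterate_succ_apply]; exact ih _

theorem mul_left_mem_opPol {F : T.Phase → T.Gar} (hF : F ∈ pol e ⊤) {R : T.Phase → T.Gar → T.Gar}
    (hR : R ∈ opPol e) : (fun η B => F η * R η B) ∈ opPol e := by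
  induction hR using Submodule.span_induction with
  | zero => simp only [Pi.zero_apply, mul_zero]; exact zero_mem (opPol e)
  | add R R' _ _ h h' => simp only [Pi.add_apply, mul_add]; exact add_mem h h'
  | smul c R _ h => simp only [Pi.smul_apply, mul_smul_comm]; exact Submodule.smul_mem _ c h
  | mem R hR =>
    obtain ⟨S, m, rfl⟩ := hR
    refine polyAlg_induction (p := fun F => (fun η B => F η * (S B *
      (m.map fun i => coord e i η).prod)) ∈ opPol e) (fun _ _ => Algebra.mem_top)
      (coord_mem_odd e) ?_ ?_ hF
    · intro X _ l
      refine Submodule.subset_span ⟨ContinuousLinearMap.mul ℂ T.Gar X ∘L (T.parL ^ l.length) ∘L S,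
        l ++ m, ?_⟩
      ext η B
      simp only [ContinuousLinearMap.comp_apply, ContinuousLinearMap.mul_apply', parL_pow_apply,
        List.map_append, List.prod_append]
      rw [mul_assoc X, ← mul_assoc _ (S B), prod_par _ (fun i => coord_mem_odd e i η), mul_assoc,
        mul_assoc]
    · intro F F' _ _ h h'
      simp only [Pi.add_apply, add_mul]
      exact add_mem h h'

theorem mul_right_mem_opPol {F : T.Phase → T.Gar} (hF : F ∈ pol e ⊤)
    {R : T.Phase → T.Gar → T.Gar} (hR : R ∈ opPol e) :
    (fun η B => R η B * F η) ∈ opPol e := by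
  induction hR using Submodule.span_induction with
  | zero => simp only [Pi.zero_apply, zero_mul]; exact zero_mem (opPol e)
  | add R R' _ _ h h' => simp only [Pi.add_apply, add_mul]; exact add_mem h h'
  | smul c R _ h => simp only [Pi.smul_apply, smul_mul_assoc]; exact Submodule.smul_mem _ c h
  | mem R hR =>
    obtain ⟨S, m, rfl⟩ := hR
    refine polyAlg_induction (p := fun F => (fun η B => S B *
      (m.map fun i => coord e i η).prod * F η) ∈ opPol e) (fun _ _ => Algebra.mem_top)
      (coord_mem_odd e) ?_ ?_ hF
    · intro X _ l
      refine Submodule.subset_span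
        ⟨(ContinuousLinearMap.mul ℂ T.Gar).flip (T.par^[m.length] X) ∘L S, m ++ l, ?_⟩
      ext η B
      simp only [ContinuousLinearMap.comp_apply, ContinuousLinearMap.flip_apply,
        ContinuousLinearMap.mul_apply', List.map_append, List.prod_append]
      rw [mul_assoc (S B), ← mul_assoc _ X, prod_par _ (fun i => coord_mem_odd e i η), mul_assoc,
        mul_assoc]
    · intro F F' _ _ h h'
      simp only [Pi.add_apply, mul_add]
      exact add_mem h h'

include hT in
-- The integral is defined by a choice of coefficients, so its dependence on `B` is controlled
-- through monomials: each contributes a scalar multiple of S B with S bounded. This yields the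
-- continuity of the average.
theorem integral_opPol {R : T.Phase → T.Gar → T.Gar} (hR : R ∈ opPol e) :
    (∀ B, (fun η => R η B) ∈ pol e ⊤) ∧
      Continuous fun B => integral e v fun η => R η B := by
  have h0 : integral e v (0 : T.Phase → T.Gar) = 0 := by
    simpa using integral_smul e v hT 0 (zero_mem (pol e ⊤))
  induction hR using Submodule.span_induction with
  | zero =>
    refine ⟨fun B => zero_mem (pol e ⊤), ?_⟩
    have : (fun B : T.Gar => integral e v fun η => (0 : T.Phase → T.Gar → T.Gar) η B) =
      fun _ => 0 := funext fun _ => h0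
    rw [this]
    exact continuous_const
  | add R R' _ _ h h' =>
    refine ⟨fun B => add_mem (h.1 B) (h'.1 B), ?_⟩
    have : (fun B : T.Gar => integral e v fun η => (R + R') η B) =
        fun B => integral e v (fun η => R η B) + integral e v fun η => R' η B :=
      funext fun B => integral_add e v hT (h.1 B) (h'.1 B)
    rw [this]
    exact h.2.add h'.2
  | smul c R _ h =>
    refine ⟨fun B => Subalgebra.smul_mem _ (h.1 B) c, ?_⟩
    have : (fun B : T.Gar => integral e v fun η => (c • R) η B) =
        fun B => c • integral e v (fun η => R η B) :=
      funext fun B => integral_smul e v hT c (h.1 B)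
    rw [this]
    exact h.2.const_smul c
  | mem R hR =>
    obtain ⟨S, l, rfl⟩ := hR
    obtain ⟨k, -, hk⟩ := exists_integral_prod e v hT l
    refine ⟨fun B => const_mul_prod_mem_pol e Algebra.mem_top l, ?_⟩
    simp only [hk]
    exact S.continuous.const_smul k

theorem continuous_average : Continuous (average e v he hT) := by
  have h0 : (fun (_ : T.Phase) (B : T.Gar) => B) ∈ opPol e :=
    Submodule.subset_span ⟨ContinuousLinearMap.id ℂ T.Gar, [], by simp⟩
  -- By definition α_{-η}(B) = w(-(-η)) B w(-η); the double negation is kept so that the terms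
  -- match.
  have h1 : (fun η => T.weyl (- -η)) ∈ pol e ⊤ := neg_mem_pol e (neg_mem_pol e (weyl_mem_pol e he))
  exact (integral_opPol e v hT (mul_right_mem_opPol e (neg_mem_pol e (weyl_mem_pol e he))
    (mul_left_mem_opPol e h1 h0))).2

/-- The average of an operator over all translations belongs to the Grassmann part. -/
theorem average_mem_grass (A : T.Gar) : average e v he hT A ∈ T.grass :=
  (T.isClosed_grass.preimage (continuous_average e v he hT)).closure_subset_iff.2
    (fun _ hB => average_normalSpan e v he hT (adjoin_le_normalSpan e he hB)) (T.dense_adjoin_G A)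

end Trace

/-! ### Convolutions and Fourier transforms -/

section Main

variable {T} {n : ℕ} (e : OrthonormalBasis (Fin (2 * n)) ℂ T.QH) (v : ⋀[ℂ]^(2 * n) T.QH)
  (he : ∀ i, T.J (e i) = e i) (hT : ¬ FiniteDimensional ℂ T.QperpH)

theorem exists_sign_smul (ε : ℤˣ) :
    ∃ t : ℂ, t ^ 2 = 1 ∧ (∀ ξ : T.Phase, (ε : ℤ) • ξ = t • ξ) ∧
      ∀ A : T.Gar, (ε : ℤ) • A = t • A := by
  refine ⟨((ε : ℤ) : ℂ), ?_, fun ξ => (Int.cast_smul_eq_zsmul ℂ _ ξ).symm,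
    fun A => (Int.cast_smul_eq_zsmul ℂ _ A).symm⟩
  rcases Int.units_eq_one_or ε with rfl | rfl <;> simp

/-- The kernel `exp(t ⟪⟪ξ⋆, η⟫⟫)` of the Fourier transform. -/
noncomputable def kernel (t : ℂ) (ξ η : T.Phase) : T.Gar := NormedSpace.exp (T.symp ξ (t • η))

include he

theorem kernel_commute (t : ℂ) (ξ η : T.Phase) (A : T.Gar) : Commute (kernel t ξ η) A :=
  exp_symp_commute e he _ _ _

theorem kernel_add (t : ℂ) (ξ η ζ : T.Phase) :
    kernel t ξ (η + ζ) = kernel t ξ η * kernel t ξ ζ := by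
  rw [kernel, smul_add, exp_symp_add e he]; rfl

theorem kernel_mem_pol₂ (t : ℂ) :
    (fun p : T.Phase × T.Phase => kernel t p.1 p.2) ∈ pol₂ e T.grass := by
  refine comp_mem_polyAlg (θ' := coord₂ e) (exp_symp_mem_pol₂ e he) (fun p => (p.1, t • p.2))
    fun i => ?_
  rcases i with i | i
  · exact var_mem_polyAlg (θ := coord₂ e) (Sum.inl i)
  · have h : (fun w : T.Phase × T.Phase => coord₂ e (Sum.inr i) (w.1, t • w.2)) =
        t • coord₂ e (Sum.inr i) := funext fun w => coord_smul e i t w.2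
    rw [h]
    exact Subalgebra.smul_mem _ (var_mem_polyAlg (θ := coord₂ e) (Sum.inr i)) t

theorem kernel_mem_pol (t : ℂ) (ξ : T.Phase) : (fun η => kernel t ξ η) ∈ pol e ⊤ :=
  slice_mem_pol e (kernel_mem_pol₂ e he t) ξ

omit he in
theorem fourierFun_eq {ε : ℤˣ} {t : ℂ} (ht : ∀ A : T.Gar, (ε : ℤ) • A = t • A)
    (f : T.Phase → T.Gar) (ξ : T.Phase) :
    fourierFun e v ε f ξ = integral e v fun η => f η * kernel t ξ η := by
  simp only [fourierFun, kernel, ht, map_smul]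

include hT

theorem fourierFun_mem {ε : ℤˣ} {t : ℂ} (ht : ∀ A : T.Gar, (ε : ℤ) • A = t • A)
    {f : T.Phase → T.Gar} (hf : f ∈ pol e T.grass) : fourierFun e v ε f ∈ pol e T.grass := by
  rw [funext (fourierFun_eq e v ht f)]
  exact integral_slice_mem_pol e v hT (fun _ => T.par_mem_grass)
    (K := fun p => f p.2 * kernel t p.1 p.2) (mul_mem (snd_mem_pol₂ e hf) (kernel_mem_pol₂ e he t))

omit he hT in
theorem sub_mem_pol₂ {M : Subalgebra ℂ T.Gar} {f : T.Phase → T.Gar} (hf : f ∈ pol e M) :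
    (fun p : T.Phase × T.Phase => f (p.1 - p.2)) ∈ pol₂ e M := by
  refine comp_mem_pol₂ e hf (fun p => p.1 - p.2) fun i => ?_
  simp only [coord_sub]
  exact sub_mem (fst_mem_pol₂ e (var_mem_polyAlg i)) (snd_mem_pol₂ e (var_mem_polyAlg i))

omit he in
theorem convFun_mem {f f' : T.Phase → T.Gar} (hf : f ∈ pol e T.grass) (hf' : f' ∈ pol e T.grass) :
    convFun e v f f' ∈ pol e T.grass :=
  integral_slice_mem_pol e v hT (fun _ => T.par_mem_grass)
    (K := fun p => f p.2 * f' (p.1 - p.2)) (mul_mem (snd_mem_pol₂ e hf) (sub_mem_pol₂ e hf'))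

omit he in
theorem integral_translate (ζ : T.Phase) {F : T.Phase → T.Gar} (hF : F ∈ pol e ⊤) :
    integral e v F = integral e v fun η => F (η + ζ) := by
  have h := integral_affine e v hT (one_pow 2) ζ hF
  simp only [one_smul] at h
  exact h.symm

omit hT in
theorem mul_kernel_mem {f : T.Phase → T.Gar} (hf : f ∈ pol e ⊤) (t : ℂ) (ξ : T.Phase) :
    (fun η => f η * kernel t ξ η) ∈ pol e ⊤ := mul_mem hf (kernel_mem_pol e he t ξ)

/-- Fubini's theorem and the shift η ↦ η + ζ separate the variables, as the kernel is a character in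
its second argument; its centrality allows it to be placed between f and f'. -/
theorem fourierFun_convFun (ε : ℤˣ) {f f' : T.Phase → T.Gar} (hf : f ∈ pol e T.grass)
    (hf' : f' ∈ pol e T.grass) :
    fourierFun e v ε (convFun e v f f') = fourierFun e v ε f * fourierFun e v ε f' := by
  obtain ⟨t, -, -, ht⟩ := exists_sign_smul (T := T) ε
  ext ξ
  have hf := pol_le_top e hf
  have hf' := pol_le_top e hf'
  have hk := kernel_mem_pol e he t ξ
  have hK : (fun p : T.Phase × T.Phase => f p.2 * f' (p.1 - p.2) * kernel t ξ p.1) ∈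
      pol₂ e ⊤ :=
    mul_mem (mul_mem (snd_mem_pol₂ e hf) (sub_mem_pol₂ e hf')) (fst_mem_pol₂ e hk)
  have h1 (η : T.Phase) : convFun e v f f' η * kernel t ξ η =
      integral e v fun ζ => f ζ * f' (η - ζ) * kernel t ξ η :=
    (integral_mul_right e v hT _ (slice_mem_pol e
      (mul_mem (snd_mem_pol₂ e hf) (sub_mem_pol₂ e hf')) η)).symm
  have h2 (ζ : T.Phase) : integral e v (fun η => f ζ * f' (η - ζ) * kernel t ξ η) =
      f ζ * kernel t ξ ζ * fourierFun e v ε f' ξ := by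
    have hs : (fun η => f ζ * f' (η - ζ) * kernel t ξ η) ∈ pol e ⊤ :=
      slice_mem_pol e (swap_mem_pol₂ e hK) ζ
    rw [integral_translate e v hT ζ hs, fourierFun_eq e v ht,
      ← integral_mul_left e v hT _ (mul_kernel_mem e he hf' t ξ)]
    refine congrArg (integral e v) (funext fun η => ?_)
    simp only [add_sub_cancel_right, kernel_add e he]
    rw [mul_assoc (f ζ) (kernel t ξ ζ), (kernel_commute e he t ξ ζ _).eq]
    simp only [mul_assoc]
  rw [Pi.mul_apply, fourierFun_eq e v ht]
  simp only [h1]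
  rw [integral_comm e v hT hK]
  simp only [h2]
  rw [integral_mul_right e v hT _ (mul_kernel_mem e he hf t ξ),
    ← fourierFun_eq e v ht]

/-- The two signs cancel in α_{-η}(w(-ξ)) = w(-ξ) e^{σ(ξ,η)}, so prefactor and kernel are absorbed
into the translated operator. F A thereby becomes an average, which is Λ-valued and right Λ-linear.
-/
theorem fourierOp_eq (A : T.Gar) (ξ : T.Phase) :
    fourierOp e v A ξ = average e v he hT (T.weyl (-ξ) * A) := by
  have hF : (fun η => T.translate (-η) A * NormedSpace.exp (T.symp ξ η)) ∈ pol e ⊤ := by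
    refine mul_mem (neg_mem_pol e (translate_mem_pol e he A)) ?_
    simpa only [kernel, one_smul] using kernel_mem_pol e he 1 ξ
  rw [fourierOp, average_apply, ← integral_mul_left e v hT _ hF]
  refine congrArg (integral e v) (funext fun η => ?_)
  rw [← translateHom_apply (-η) (T.weyl (-ξ) * A), map_mul, translateHom_apply, translateHom_apply,
    translate_weyl e he, map_neg, map_neg, LinearMap.neg_apply, neg_neg, mul_assoc,
    (exp_symp_commute e he ξ η _).eq]

theorem fourierOp_mem (A : T.Gar) : fourierOp e v A ∈ pol e T.grass := by
  rw [funext (fourierOp_eq e v he hT A)]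
  exact map_mem_pol e (average e v he hT) (average_mul_grass e v he hT)
    (average_mem_grass e v he hT)
    (mul_right_mem_pol e Algebra.mem_top (neg_mem_pol e (weyl_mem_pol e he)))

omit hT in
theorem translate_smul_mem (t : ℂ) (A : T.Gar) : (fun η => T.translate (t • η) A) ∈ pol e ⊤ :=
  smul_mem_pol e (translate_mem_pol e he A) t

theorem fourierOp_convOpFun (ε : ℤˣ) (A : T.Gar) {f : T.Phase → T.Gar}
    (hf : f ∈ pol e T.grass) :
    fourierOp e v (convOpFun e v ε A f) = fourierOp e v A * fourierFun e v ε f := by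
  obtain ⟨t, -, ht', ht⟩ := exists_sign_smul (T := T) ε
  ext ξ
  have hfg := pol_grass_apply_mem e hf
  have hf := pol_le_top e hf
  have hk := kernel_mem_pol e he t ξ
  have hk1 := kernel_mem_pol e he 1 ξ
  have hα := translate_mem_pol e he A
  have hA : (fun η => T.translate (-η) A * kernel 1 ξ η) ∈ pol e ⊤ :=
    mul_mem (neg_mem_pol e hα) hk1
  have hd : (fun p : T.Phase × T.Phase => T.translate (t • p.2 - p.1) A) ∈ pol₂ e ⊤ := by
    refine comp_mem_pol₂ e hα (fun p => t • p.2 - p.1) fun i => ?_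
    simp only [coord_sub, coord_smul]
    exact sub_mem (Subalgebra.smul_mem _ (snd_mem_pol₂ e (var_mem_polyAlg i)) t)
      (fst_mem_pol₂ e (var_mem_polyAlg i))
  have hK : (fun p : T.Phase × T.Phase => T.translate (t • p.2 - p.1) A * f p.2 *
      kernel 1 ξ p.1) ∈ pol₂ e ⊤ :=
    mul_mem (mul_mem hd (snd_mem_pol₂ e hf)) (fst_mem_pol₂ e hk1)
  have hc : (fun ζ => T.translate (t • ζ) A * f ζ) ∈ pol e ⊤ :=
    mul_mem (translate_smul_mem e he t A) hf
  have h1 (η : T.Phase) : T.translate (-η) (convOpFun e v ε A f) * NormedSpace.exp (T.symp ξ η) =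
      integral e v fun ζ => T.translate (t • ζ - η) A * f ζ * kernel 1 ξ η := by
    have h2 : (fun ζ => T.weyl (- -η) * (T.translate (t • ζ) A * f ζ)) ∈ pol e ⊤ :=
      mul_left_mem_pol e Algebra.mem_top hc
    have h3 : (fun ζ => T.weyl (- -η) * (T.translate (t • ζ) A * f ζ) * T.weyl (-η)) ∈ pol e ⊤ :=
      mul_right_mem_pol e Algebra.mem_top h2
    simp only [convOpFun, ht']
    -- α_{-η} is multiplication by constants from both sides, so it passes under the integral over
    -- ζ; there it fixes f(ζ) in Λ and combines with the other translation.
    rw [translate, ← integral_mul_left e v hT _ hc, ← integral_mul_right e v hT _ h2,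
      ← integral_mul_right e v hT _ h3]
    refine congrArg (integral e v) (funext fun ζ => ?_)
    have h4 : T.weyl (- -η) * (T.translate (t • ζ) A * f ζ) * T.weyl (-η) =
        T.translateHom (-η) (T.translate (t • ζ) A * f ζ) := rfl
    rw [h4, map_mul, translateHom_apply, translateHom_apply, translate_translate e he,
      translate_grass e _ (hfg ζ), kernel, one_smul, neg_add_eq_sub]
  have h2 (ζ : T.Phase) :
      integral e v (fun η => T.translate (t • ζ - η) A * f ζ * kernel 1 ξ η) =
      integral e v (fun η => T.translate (-η) A * kernel 1 ξ η) * (f ζ * kernel t ξ ζ) := by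
    have hs : (fun η => T.translate (t • ζ - η) A * f ζ * kernel 1 ξ η) ∈ pol e ⊤ :=
      slice_mem_pol e (swap_mem_pol₂ e hK) ζ
    -- The shift by tζ turns α_{tζ-η} into α_{-η} and releases e^{σ(ξ,tζ)}, exactly the kernel of F
    -- f with its sign.
    rw [integral_translate e v hT (t • ζ) hs,
      ← integral_mul_right e v hT _ hA]
    refine congrArg (integral e v) (funext fun η => ?_)
    have h3 : kernel 1 ξ (t • ζ) = kernel t ξ ζ := by simp only [kernel, one_smul]
    simp only [sub_add_cancel_right, sub_add_cancel_left, sub_add_eq_sub_sub_swap, sub_self, zero_sub,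
      kernel_add e he, h3]
    rw [mul_assoc (T.translate _ _),
      mul_assoc (T.translate _ _), ← mul_assoc (f ζ), ← (kernel_commute e he 1 ξ η (f ζ)).eq,
      mul_assoc (kernel 1 ξ η)]
  rw [Pi.mul_apply, fourierOp, fourierOp, fourierFun_eq e v ht]
  simp only [h1]
  rw [integral_comm e v hT hK]
  simp only [h2]
  rw [integral_mul_left e v hT _ (mul_kernel_mem e he hf t ξ)]
  simp only [kernel, one_smul, mul_assoc]

omit he hT in
theorem kernel_mem_grass (t : ℂ) (ξ η : T.Phase) (he : ∀ i, T.J (e i) = e i) :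
    kernel t ξ η ∈ T.grass := by
  refine polyAlg_induction (p := fun F => F (ξ, η) ∈ T.grass) (fun _ => T.par_mem_grass)
    (coord₂_mem_odd e) (fun X hX l => mul_mem hX (list_prod_mem ?_)) (fun _ _ _ _ => add_mem)
    (kernel_mem_pol₂ e he t)
  simp only [List.mem_map]
  rintro _ ⟨i, _, rfl⟩
  exact T.odd_le_grass (coord₂_mem_odd e i _)

omit he hT in
/-- A right module homomorphism as a linear map into the GAR algebra. -/
noncomputable def homVal (φ : T.Gar →L[ℂ] T.grass) : T.Gar →ₗ[ℂ] T.Gar :=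
  T.grass.val.toLinearMap ∘ₗ φ.toLinearMap

omit he hT in
theorem homVal_mem (φ : T.Gar →L[ℂ] T.grass) (A : T.Gar) : homVal φ A ∈ T.grass := (φ A).2

omit he hT in
theorem homVal_mul {φ : T.Gar →L[ℂ] T.grass} (hφ : T.IsRightModuleHom φ) (A : T.Gar) :
    ∀ l ∈ T.grass, homVal φ (A * l) = homVal φ A * l := fun l hl =>
  congrArg Subtype.val (hφ A ⟨l, hl⟩)

omit hT in
theorem fourierHom_mem {φ : T.Gar →L[ℂ] T.grass} (hφ : T.IsRightModuleHom φ) :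
    fourierHom φ ∈ pol e T.grass :=
  map_mem_pol e (homVal φ) (homVal_mul hφ) (homVal_mem φ) (weyl_mem_pol e he)

omit hT in
theorem translate_neg_smul_mem (t : ℂ) (A : T.Gar) :
    (fun η => T.translate (-(t • η)) A) ∈ pol e ⊤ :=
  smul_mem_pol e (neg_mem_pol e (translate_mem_pol e he A)) t

omit hT in
theorem convHomOp_mem (ε : ℤˣ) {φ : T.Gar →L[ℂ] T.grass} (hφ : T.IsRightModuleHom φ)
    (A : T.Gar) : convHomOp ε φ A ∈ pol e T.grass := by
  obtain ⟨t, -, ht, -⟩ := exists_sign_smul (T := T) ε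
  have h := map_mem_pol e (homVal φ) (homVal_mul hφ) (homVal_mem φ)
    (translate_neg_smul_mem e he t A)
  simp only [← ht] at h
  exact h

/-- The Λ-valued kernel moves inside φ, then so does the integral. The sign in the convolution
matches the one in the kernel, so both disappear under the reflection η ↦ tη, which preserves the
integral. -/
theorem fourierFun_convHomOp (ε : ℤˣ) {φ : T.Gar →L[ℂ] T.grass} (hφ : T.IsRightModuleHom φ)
    (A : T.Gar) :
    fourierFun e v ε (convHomOp ε φ A) = fourierHom φ * fourierOp e v A := by
  obtain ⟨t, ht2, ht', ht⟩ := exists_sign_smul (T := T) ε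
  ext ξ
  have hF : (fun η => T.translate (-η) A * kernel 1 ξ η) ∈ pol e ⊤ :=
    mul_kernel_mem e he (neg_mem_pol e (translate_mem_pol e he A)) 1 ξ
  have h1 (η : T.Phase) : convHomOp ε φ A η * kernel t ξ η =
      homVal φ (T.translate (-(t • η)) A * kernel 1 ξ (t • η)) := by
    have h2 : kernel 1 ξ (t • η) = kernel t ξ η := by simp only [kernel, one_smul]
    rw [h2, homVal_mul hφ _ _ (kernel_mem_grass e t ξ η he), convHomOp, ht']
    rfl
  have h3 := integral_affine e v hT ht2 0 hF
  simp only [add_zero] at h3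
  rw [Pi.mul_apply, fourierFun_eq e v ht]
  simp only [h1]
  rw [integral_map e v hT (homVal φ) (homVal_mul hφ) (smul_mem_pol e hF t), h3]
  have h4 : fourierHom φ ξ = homVal φ (T.weyl ξ) := rfl
  have h5 : fourierOp e v A ξ = T.weyl (-ξ) *
      integral e v fun η => T.translate (-η) A * kernel 1 ξ η := by
    simp only [fourierOp, kernel, one_smul]
  -- Since F A(ξ) lies in Λ, it may be taken inside φ, where w(ξ) cancels the prefactor w(-ξ).
  rw [h4, ← homVal_mul hφ _ _ (pol_grass_apply_mem e (fourierOp_mem e v he hT A) ξ), h5,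
    ← mul_assoc, weyl_mul_weyl_neg, one_mul]

end Main

end GARTriple

theorem mainTheorem4 {H : Type*} [NormedAddCommGroup H] [InnerProductSpace ℂ H] [CompleteSpace H]
    (T : GARTriple H) (hT : ¬ FiniteDimensional ℂ T.QperpH)
    (n : ℕ) (e : OrthonormalBasis (Fin (2 * n)) ℂ T.QH) (he : ∀ i, T.J (e i) = e i)
    (v : ⋀[ℂ]^(2 * n) T.QH) (ε : ℤˣ) :
    (∀ f ∈ T.hol, ∀ f' ∈ T.hol,
      GARTriple.convFun e v f f' ∈ T.hol ∧ GARTriple.fourierFun e v ε f ∈ T.hol ∧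
      GARTriple.fourierFun e v ε (GARTriple.convFun e v f f') =
        GARTriple.fourierFun e v ε f * GARTriple.fourierFun e v ε f') ∧
    (∀ φ : T.Gar →L[ℂ] T.grass, T.IsRightModuleHom φ → ∀ A : T.Gar,
      GARTriple.convHomOp ε φ A ∈ T.hol ∧ GARTriple.fourierHom φ ∈ T.hol ∧
      GARTriple.fourierOp e v A ∈ T.hol ∧
      GARTriple.fourierFun e v ε (GARTriple.convHomOp ε φ A) =
        GARTriple.fourierHom φ * GARTriple.fourierOp e v A) ∧
    (∀ A : T.Gar, ∀ f ∈ T.hol,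
      GARTriple.fourierOp e v (GARTriple.convOpFun e v ε A f) =
        GARTriple.fourierOp e v A * GARTriple.fourierFun e v ε f) := by
  have hp := GARTriple.hol_eq_pol e
  simp only [hp]
  exact ⟨fun f hf f' hf' => ⟨GARTriple.convFun_mem e v hT hf hf',
      GARTriple.fourierFun_mem e v he hT (GARTriple.exists_sign_smul ε).choose_spec.2.2 hf,
      GARTriple.fourierFun_convFun e v he hT ε hf hf'⟩,
    fun φ hφ A => ⟨GARTriple.convHomOp_mem e he ε hφ A, GARTriple.fourierHom_mem e he hφ,
      GARTriple.fourierOp_mem e v he hT A, GARTriple.fourierFun_convHomOp e v he hT ε hφ A⟩,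
    fun A f hf => GARTriple.fourierOp_convOpFun e v he hT ε A hf⟩
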